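/- For a finite group $G$, let $\sigma(G)$ be the least number of proper subgroups of $G$ whose set-theoretical union is $G$, with $\sigma(G)=\infty$ if $G$ is cyclic (and $n<\infty$ for every integer $n$). A finite group $G$ is called $\sigma$-elementary if $\sigma(G)<\sigma(G/N)$ for every non-trivial normal subgroup $N$ of $G$; it is called monolithic if it has exactly one minimal normal subgroup; and $\operatorname{soc}(G)$ denotes the socle of $G$, the subgroup generated by all minimal normal subgroups of $G$. Let $G$ be a finite solvable non-abelian group. Then $G$ is $\sigma$-elementary if and only if $G$ is monolithic and $G/\operatorname{soc}(G)$ is cyclic. In this case $\sigma(G)=|\operatorname{soc}(G)|+1$. -/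

import Mathlib

/-- A family of proper subgroups of `G` whose set-theoretical union is `G`. -/
def IsSubgroupCover (G : Type*) [Group G] (F : Set (Subgroup G)) : Prop :=
  (∀ H ∈ F, H ≠ ⊤) ∧ ∀ g : G, ∃ H ∈ F, g ∈ H

/-- The sum of `G`: the least cardinality of a cover of `G` by proper subgroups, and `⊤ = ∞`
if there is no cover (for a finite group: if and only if the group is cyclic, see
`groupSum_eq_top_iff` below). -/
noncomputable def groupSum (G : Type*) [Group G] : ℕ∞ :=
  sInf {n : ℕ∞ | ∃ F : Set (Subgroup G), IsSubgroupCover G F ∧ F.encard = n}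

/-- `G` is `σ`-elementary: `σ(G) < σ(G/N)` for every nontrivial normal subgroup `N`. -/
def IsSigmaElementary (G : Type*) [Group G] : Prop :=
  ∀ (N : Subgroup G) [N.Normal], N ≠ ⊥ → groupSum G < groupSum (G ⧸ N)

/-- Minimal normal subgroups: minimal among the nontrivial normal subgroups. -/
def IsMinimalNormal {G : Type*} [Group G] (N : Subgroup G) : Prop :=
  Minimal (fun M : Subgroup G => M.Normal ∧ M ≠ ⊥) N

/-- A group is monolithic if it has exactly one minimal normal subgroup. -/
def IsMonolithic (G : Type*) [Group G] : Prop :=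
  ∃! N : Subgroup G, IsMinimalNormal N

/-- The socle: the subgroup generated by all the minimal normal subgroups. -/
def groupSocle (G : Type*) [Group G] : Subgroup G :=
  sSup {N : Subgroup G | IsMinimalNormal N}

instance groupSocle_normal (G : Type*) [Group G] : (groupSocle G).Normal :=
  Subgroup.sSup_normal _ fun N (hN : IsMinimalNormal N) => hN.1.1

theorem groupSum_eq_top_iff (G : Type*) [Group G] [Finite G] :
    groupSum G = ⊤ ↔ IsCyclic G := by
  constructor
  · intro h
    by_contra hc
    have hF : IsSubgroupCover G (Set.range fun g : G => Subgroup.zpowers g) := by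
      refine ⟨?_, fun g => ⟨_, ⟨g, rfl⟩, Subgroup.mem_zpowers g⟩⟩
      rintro _ ⟨g, rfl⟩ hg
      refine hc ⟨g, fun x => ?_⟩
      have : x ∈ (⊤ : Subgroup G) := Subgroup.mem_top x
      rwa [← hg] at this
    have h1 : groupSum G ≤ (Set.range fun g : G => Subgroup.zpowers g).encard :=
      sInf_le ⟨_, hF, rfl⟩
    rw [h, top_le_iff, Set.encard_eq_top_iff] at h1
    exact h1 (Set.finite_range _)
  · rintro ⟨g, hg⟩
    refine sInf_eq_top.2 ?_
    rintro _ ⟨F, hF, -⟩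
    obtain ⟨H, hH, hgH⟩ := hF.2 g
    refine absurd ?_ (hF.1 H hH)
    rw [eq_top_iff]
    intro x _
    exact (Subgroup.zpowers_le.2 hgH) (hg x)

/-!
The idea, for a finite solvable nonabelian group `G`.

Suppose first that `N` is a minimal normal subgroup and `G / N` is cyclic, generated by the image of
`x`. A proper subgroup meeting the coset `N x` is a complement of `N` and contains exactly one element
of this coset, so a cover needs `|N|` such subgroups and one more to cover `N`
(`card_add_one_le_groupSum_of_isCyclic_quotient`). Conversely, if all proper quotients are cyclic, `N`
together with the cyclic groups generated by the elements of `N x` is a cover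
(`groupSum_le_of_critical`). Proper quotients of a monolithic group with cyclic quotient by the
socle are cyclic, so they are not unions of proper subgroups and `G` is `σ`-elementary.

Now let `G` be `σ`-elementary, and take a minimal normal subgroup `N` inside the derived subgroup.
As `σ(G) < σ(G / N)`, the subgroup `N` has a complement `H`, which is maximal and not normal, and a
cover with fewer than `σ(G / N)` members contains all `|N|` conjugates of `H`: on a conjugate of `H`
that is not a member it would trace a cover by proper subgroups, while `H ≅ G / N`. Hence `|N| + 1 ≤ σ(G)` (`card_add_one_le_groupSum_of_lt`). On the other hand, if a
noncyclic quotient of `G` is reached by a chain of normal subgroups with abelian factors of order at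
most `|N|`, then the first noncyclic quotient along the chain is cyclic modulo an abelian group of
order at most `|N|`, so `σ(G) ≤ |N| + 1` (`AbChain.groupSum_le`) and this quotient is `G` itself. There
is such a chain from `G` through `C = C_G(N)` to `C ∩ H`. As `G / (C ∩ H)` is not cyclic,
`C ∩ H = 1` and `C = N`; as `σ(G / N) > σ(G)`, the quotient `G / N` is cyclic. Finally `C = N` makes
`N` the only minimal normal subgroup.

The chain from `G` to `C_G(N)` is the substance of the proof: a finite solvable group acting
irreducibly on `V` has a chain of normal subgroups down to the kernel with abelian factors of order
at most `|V|` (`linearBound`). This goes by induction on the order of the image. Let `A` be a maximal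
abelian normal subgroup of the image. If `A` does not act through a field, then `V` is a direct sum of
`t` conjugate proper subspaces (`LinearBound.chain_of_imprimitive`); the action on the set of summands
is handled through primitive permutation groups (`LinearBound.chain_normalCore`), and normal cores
carry the chain of the stabilizer of a summand `U`, with factors of order at most `|U|`, to factors of
order at most `|U| ^ t = |V|`. If `A` acts by scalars from a field `E`, then `A` is cyclic, and a chief
factor `B / A` centralizing `A` satisfies `|B / A| ≤ (dim_E V) ^ 2 ≤ |E| ^ dim_E V = |V|`, because
coset representatives of `A` in `B` are linearly independent endomorphisms
(`relIndex_le_finrank_sq`). The group acts on `B / A` irreducibly, so the induction hypothesis leads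
down to the centralizer of `B / A`, and the elements centralizing both `A` and `B / A` act on `B`
through at most `|B / A|` characters (`LinearBound.chain_of_scalar`).
-/

universe u

open scoped commutatorElement IsMulCommutative

/-! ### Chains of normal subgroups with small abelian factors -/

/-- `Y ≤ X` are normal subgroups of `G` and `X / Y` is abelian of order at most `n`. -/
structure AbStep {G : Type*} [Group G] (n : ℕ) (X Y : Subgroup G) : Prop where
  normal_left : X.Normal
  normal_right : Y.Normal
  le : Y ≤ X
  comm : ⁅X, X⁆ ≤ Y
  relIndex_le : Y.relIndex X ≤ n

/-- There is a descending chain from `X` to `Y` of normal subgroups of `G` all of whose factors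
are abelian of order at most `n`. -/
def AbChain {G : Type*} [Group G] (n : ℕ) (X Y : Subgroup G) : Prop :=
  Relation.ReflTransGen (AbStep n) X Y

section Chains

variable {G : Type*} [Group G]

theorem relIndex_ne_zero_of_finite [Finite G] (H K : Subgroup G) : H.relIndex K ≠ 0 :=
  Subgroup.index_ne_zero_of_finite

theorem AbStep.mono {n m : ℕ} (hnm : n ≤ m) {X Y : Subgroup G} (h : AbStep n X Y) :
    AbStep m X Y :=
  ⟨h.1, h.2, h.3, h.4, h.5.trans hnm⟩

theorem AbChain.mono {n m : ℕ} (hnm : n ≤ m) {X Y : Subgroup G} (h : AbChain n X Y) :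
    AbChain m X Y :=
  Relation.ReflTransGen.mono (fun _ _ => AbStep.mono hnm) _ _ h

theorem AbStep.chain {n : ℕ} {X Y : Subgroup G} (h : AbStep n X Y) : AbChain n X Y :=
  Relation.ReflTransGen.single h

theorem AbStep.inf [Finite G] {n : ℕ} {X Y : Subgroup G} (h : AbStep n X Y) (Z : Subgroup G)
    [hZ : Z.Normal] : AbStep n (X ⊓ Z) (Y ⊓ Z) where
  normal_left := by have := h.1; infer_instance
  normal_right := by have := h.2; infer_instance
  le := inf_le_inf_right _ h.3
  comm := le_inf ((Subgroup.commutator_mono inf_le_left inf_le_left).trans h.4)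
    ((Subgroup.commutator_mono inf_le_right inf_le_right).trans (Subgroup.commutator_le_left Z Z))
  relIndex_le := by
    have h1 : (Y ⊓ Z).relIndex (X ⊓ Z) = Y.relIndex (X ⊓ Z) := by
      rw [← Subgroup.inf_relIndex_right (Y ⊓ Z), ← Subgroup.inf_relIndex_right Y]
      congr 1
      ext x
      simp only [Subgroup.mem_inf]
      tauto
    rw [h1]
    exact (Subgroup.relIndex_le_of_le_right inf_le_left (relIndex_ne_zero_of_finite _ _)).trans h.5

theorem AbChain.inf [Finite G] {n : ℕ} {X Y : Subgroup G} (h : AbChain n X Y) (Z : Subgroup G)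
    [Z.Normal] : AbChain n (X ⊓ Z) (Y ⊓ Z) :=
  Relation.ReflTransGen.lift (r := AbStep n) (p := AbStep n) (· ⊓ Z) (fun _ _ hs => AbStep.inf hs Z) _ _ h

theorem AbStep.comap {G' : Type*} [Group G'] [Finite G'] {n : ℕ} {X Y : Subgroup G'}
    (h : AbStep n X Y) (f : G →* G') : AbStep n (X.comap f) (Y.comap f) where
  normal_left := h.1.comap f
  normal_right := h.2.comap f
  le := Subgroup.comap_mono h.3
  comm := by
    rw [← Subgroup.map_le_iff_le_comap, Subgroup.map_commutator]
    exact (Subgroup.commutator_mono (Subgroup.map_comap_le _ _)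
      (Subgroup.map_comap_le _ _)).trans h.4
  relIndex_le := by
    rw [Subgroup.relIndex_comap]
    exact (Subgroup.relIndex_le_of_le_right (Subgroup.map_comap_le _ _)
      (relIndex_ne_zero_of_finite _ _)).trans h.5

theorem AbChain.comap {G' : Type*} [Group G'] [Finite G'] {n : ℕ} {X Y : Subgroup G'}
    (h : AbChain n X Y) (f : G →* G') : AbChain n (X.comap f) (Y.comap f) :=
  Relation.ReflTransGen.lift (r := AbStep n) (p := AbStep n) (Subgroup.comap f)
    (fun _ _ hs => AbStep.comap hs f) _ _ h

open scoped Pointwise in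
/-- Passing to normal cores turns a normal section of a subgroup `H` of index `t` into a normal
section of `G` that embeds into a product of `t` conjugate copies. -/
theorem AbStep.normalCore [Finite G] {H : Subgroup G} {n : ℕ} {X Y : Subgroup H}
    (h : AbStep n X Y) :
    AbStep (n ^ H.index) (X.map H.subtype).normalCore (Y.map H.subtype).normalCore where
  normal_left := inferInstance
  normal_right := inferInstance
  le := Subgroup.normalCore_mono (Subgroup.map_mono h.3)
  comm := by
    refine Subgroup.normal_le_normalCore.2 ?_
    refine (Subgroup.commutator_mono (Subgroup.normalCore_le _)
      (Subgroup.normalCore_le _)).trans ?_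
    rw [← Subgroup.map_commutator]
    exact Subgroup.map_mono h.4
  relIndex_le := by
    classical
    have := h.2
    let _ : Fintype (G ⧸ H) := Fintype.ofFinite _
    set X' := X.map H.subtype
    set Y' := Y.map H.subtype
    let f : G ⧸ H → Subgroup G := fun i => MulAut.conj i.out • Y'
    have h1 : ⨅ i, f i ≤ Y'.normalCore := by
      intro g hg b
      rw [Subgroup.mem_iInf] at hg
      have h2 := hg ((b⁻¹ : G) : G ⧸ H)
      obtain ⟨k, hk⟩ := QuotientGroup.mk_out_eq_mul H b⁻¹
      simp only [f, Subgroup.mem_pointwise_smul_iff_inv_smul_mem, hk] at h2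
      obtain ⟨y, hy, hy'⟩ := h2
      refine ⟨k * y * k⁻¹, this.conj_mem y hy k, ?_⟩
      simp only [map_mul, map_inv, hy', Subgroup.subtype_apply]
      simp [← map_inv, MulAut.conj_apply, mul_assoc]
    have h2 : ∀ i, (f i).relIndex X'.normalCore ≤ n := by
      intro i
      have h3 : X'.normalCore ≤ MulAut.conj (i.out : G) • X' := by
        intro g hg
        rw [Subgroup.mem_pointwise_smul_iff_inv_smul_mem]
        have := hg (i.out)⁻¹
        simpa [← map_inv, MulAut.conj_apply] using this
      refine (Subgroup.relIndex_le_of_le_right h3 (relIndex_ne_zero_of_finite _ _)).trans ?_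
      rw [Subgroup.relIndex_pointwise_smul,
        Subgroup.relIndex_map_map_of_injective _ _ H.subtype_injective]
      exact h.5
    calc Y'.normalCore.relIndex X'.normalCore
        ≤ (⨅ i, f i).relIndex X'.normalCore :=
          Subgroup.relIndex_le_of_le_left h1 (relIndex_ne_zero_of_finite _ _)
      _ ≤ ∏ i, (f i).relIndex X'.normalCore := Subgroup.relIndex_iInf_le _
      _ ≤ ∏ _i : G ⧸ H, n := Finset.prod_le_prod' fun i _ => h2 i
      _ = n ^ H.index := by
        rw [Finset.prod_const, Finset.card_univ, Subgroup.index_eq_card, Nat.card_eq_fintype_card]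

theorem AbChain.normalCore [Finite G] {H : Subgroup G} {n : ℕ} {X Y : Subgroup H}
    (h : AbChain n X Y) :
    AbChain (n ^ H.index) (X.map H.subtype).normalCore (Y.map H.subtype).normalCore :=
  Relation.ReflTransGen.lift (r := AbStep n) (p := AbStep (n ^ H.index))
    (fun X : Subgroup H => (X.map H.subtype).normalCore) (fun _ _ hs => AbStep.normalCore hs) _ _ h

/-- If `K < W` are normal subgroups of a finite solvable group with no normal subgroup strictly
between them, then `W / K` is abelian. -/
theorem commutator_le_of_chief [Group.IsSolvable G] {K W : Subgroup G} [hK : K.Normal]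
    [hW : W.Normal] (hKW : K < W)
    (hmin : ∀ Z : Subgroup G, Z.Normal → K ≤ Z → Z < W → Z = K) : ⁅W, W⁆ ≤ K := by
  by_contra hc
  have h1 : ⁅W, W⁆ ⊔ K = W := by
    by_contra hne
    have hle : ⁅W, W⁆ ⊔ K ≤ W := sup_le (Subgroup.commutator_le_left W W) hKW.le
    have := hmin (⁅W, W⁆ ⊔ K) inferInstance le_sup_right (lt_of_le_of_ne hle hne)
    exact hc (le_sup_left.trans this.le)
  have : Group.IsSolvable (G ⧸ K) :=
    Group.isSolvable_of_surjective (QuotientGroup.mk'_surjective K)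
  have h2 : W.map (QuotientGroup.mk' K) ≠ ⊥ := by
    intro h
    rw [Subgroup.map_eq_bot_iff, QuotientGroup.ker_mk'] at h
    exact hKW.not_ge h
  have h3 := Group.IsSolvable.commutator_lt_of_ne_bot h2
  rw [← Subgroup.map_commutator] at h3
  refine h3.ne ?_
  conv_rhs => rw [← h1]
  rw [Subgroup.map_sup, (Subgroup.map_eq_bot_iff K).2 (QuotientGroup.ker_mk' K).ge, sup_bot_eq]

/-- Above a normal subgroup `K` properly contained in a normal subgroup `X` of a finite group
there is a chief factor `W / K` with `W ≤ X`. -/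
theorem exists_chief_above [Finite G] {K X : Subgroup G} [hX : X.Normal] (hKX : K < X) :
    ∃ W : Subgroup G, W.Normal ∧ K < W ∧ W ≤ X ∧
      ∀ Z : Subgroup G, Z.Normal → K ≤ Z → Z < W → Z = K := by
  obtain ⟨W, hWX, hW⟩ := (Set.toFinite {Z : Subgroup G | Z.Normal ∧ K < Z}).exists_le_minimal
    (a := X) ⟨hX, hKX⟩
  refine ⟨W, hW.prop.1, hW.prop.2, hWX, fun Z hZ hKZ hZW => ?_⟩
  by_contra hne
  exact hZW.not_ge (hW.le_of_le ⟨hZ, lt_of_le_of_ne hKZ (Ne.symm hne)⟩ hZW.le)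

end Chains

/-! ### Irreducible actions, chief factors and permutation groups -/

/-- The ring of endomorphisms of an additive abelian group. -/
abbrev AddEnd (V : Type*) [AddCommGroup V] := AddMonoid.End V

/-- An action `ρ` of a group on a nontrivial additive abelian group `V` is irreducible if `⊥` and
`⊤` are the only invariant subgroups. -/
def IsIrredAction {L V : Type*} [Group L] [AddCommGroup V] (ρ : L →* AddEnd V) : Prop :=
  Nontrivial V ∧ ∀ U : AddSubgroup V, (∀ l, ∀ v ∈ U, ρ l v ∈ U) → U = ⊥ ∨ U = ⊤

/-- The bound on linear groups, for groups of order less than `n`: if a finite solvable group acts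
irreducibly on `V` with image of order less than `n`, then there is a chain of normal subgroups
from the whole group to the kernel of the action with abelian factors of order at most `|V|`. -/
def LinearBound (n : ℕ) : Prop :=
  ∀ (L : Type u) [Group L] [Finite L] [Group.IsSolvable L] (V : Type u) [AddCommGroup V]
    [Finite V] (ρ : L →* AddEnd V), IsIrredAction ρ → ρ.ker.index < n →
    AbChain (Nat.card V) ⊤ ρ.ker

/-- The action of a group by conjugation on an abelian normal subgroup, written additively. -/
def conjEnd {G : Type*} [Group G] (N : Subgroup G) [N.Normal] [IsMulCommutative N] :
    G →* AddEnd (Additive N) where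
  toFun g := MonoidHom.toAdditive (MulAut.conjNormal g).toMonoidHom
  map_one' := by
    refine AddMonoidHom.ext fun x => Subtype.ext ?_
    change (1 : G) * (x.toMul : G) * 1⁻¹ = x.toMul
    group
  map_mul' g h := by
    refine AddMonoidHom.ext fun x => Subtype.ext ?_
    change g * h * (x.toMul : G) * (g * h)⁻¹ = g * (h * x.toMul * h⁻¹) * g⁻¹
    group

theorem conjEnd_apply {G : Type*} [Group G] (N : Subgroup G) [N.Normal] [IsMulCommutative N]
    (g : G) (x : Additive N) :
    ((conjEnd N g x).toMul : G) = g * x.toMul * g⁻¹ := rfl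

theorem ker_conjEnd {G : Type*} [Group G] (N : Subgroup G) [N.Normal] [IsMulCommutative N] :
    (conjEnd N).ker = Subgroup.centralizer (N : Set G) := by
  ext g
  rw [MonoidHom.mem_ker, Subgroup.mem_centralizer_iff]
  constructor
  · intro h x hx
    have h1 := conjEnd_apply N g (Additive.ofMul ⟨x, hx⟩)
    rw [h] at h1
    have h2 : x = g * x * g⁻¹ := h1
    rw [eq_mul_inv_iff_mul_eq] at h2
    exact h2
  · intro h
    ext x
    rw [conjEnd_apply]
    have := h x.toMul x.toMul.2
    rw [← this, mul_inv_cancel_right]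
    rfl

theorem isIrredAction_conjEnd {G : Type*} [Group G] (N : Subgroup G) [N.Normal]
    [IsMulCommutative N] (hN : N ≠ ⊥)
    (hmin : ∀ Z : Subgroup G, Z.Normal → Z < N → Z = ⊥) : IsIrredAction (conjEnd N) := by
  refine ⟨?_, fun U hU => ?_⟩
  · have := (Subgroup.nontrivial_iff_ne_bot N).2 hN
    exact inferInstanceAs (Nontrivial N)
  let Z : Subgroup G := (AddSubgroup.toSubgroup' U).map N.subtype
  have hmem : ∀ x : N, (x : G) ∈ Z ↔ Additive.ofMul x ∈ U := by
    intro x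
    constructor
    · rintro ⟨y, hy, hyx⟩
      have : y = x := Subtype.ext hyx
      exact this ▸ hy
    · intro h
      exact ⟨x, h, rfl⟩
  have hZN : Z ≤ N := by
    rintro _ ⟨x, -, rfl⟩
    exact x.2
  have hZ : Z.Normal := by
    refine ⟨fun x hx g => ?_⟩
    exact (hmem (conjEnd N g (Additive.ofMul ⟨x, hZN hx⟩)).toMul).2
      (hU g _ ((hmem ⟨x, hZN hx⟩).1 hx))
  rcases hZN.lt_or_eq with h | h
  · left
    have h1 := hmin Z hZ h
    rw [eq_bot_iff]
    intro x hx
    have h2 := (hmem x.toMul).2 hx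
    rw [h1, Subgroup.mem_bot] at h2
    exact Subtype.ext h2
  · right
    rw [eq_top_iff]
    intro x _
    refine (hmem x.toMul).1 ?_
    rw [h]
    exact x.toMul.2

/-- The centralizer in `G` of a section `W / K`. -/
def sectionCentralizer {G : Type*} [Group G] (K W : Subgroup G) [K.Normal] : Subgroup G :=
  (Subgroup.centralizer (W.map (QuotientGroup.mk' K) : Set (G ⧸ K))).comap (QuotientGroup.mk' K)

theorem mem_sectionCentralizer {G : Type*} [Group G] {K W : Subgroup G} [K.Normal] {g : G} :
    g ∈ sectionCentralizer K W ↔ ∀ w ∈ W, ⁅g, w⁆ ∈ K := by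
  simp only [sectionCentralizer, Subgroup.mem_comap, Subgroup.mem_centralizer_iff,
    SetLike.mem_coe, Subgroup.mem_map, forall_exists_index, and_imp, forall_apply_eq_imp_iff₂]
  refine forall₂_congr fun w hw => ?_
  rw [← QuotientGroup.eq_one_iff, eq_comm, ← commutatorElement_eq_one_iff_mul_comm,
    ← map_commutatorElement]
  rfl

instance sectionCentralizer_normal {G : Type*} [Group G] (K W : Subgroup G) [K.Normal]
    [hW : W.Normal] : (sectionCentralizer K W).Normal := by
  have : (W.map (QuotientGroup.mk' K)).Normal := hW.map _ (QuotientGroup.mk'_surjective K)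
  unfold sectionCentralizer
  infer_instance

/-- The action of `G` on a chief factor `W / K` is irreducible, so the linear bound applies. -/
theorem LinearBound.chain_sectionCentralizer {n : ℕ} (hn : LinearBound.{u} n) {L : Type u}
    [Group L] [Finite L] [Group.IsSolvable L] {K W : Subgroup L} [hK : K.Normal]
    [hW : W.Normal] (hKW : K < W)
    (hmin : ∀ Z : Subgroup L, Z.Normal → K ≤ Z → Z < W → Z = K)
    (hlt : (sectionCentralizer K W).index < n) :
    AbChain (K.relIndex W) ⊤ (sectionCentralizer K W) := by
  set f := QuotientGroup.mk' K with hf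
  set N := W.map f with hN
  have hsurj : Function.Surjective f := QuotientGroup.mk'_surjective K
  have hker : f.ker = K := QuotientGroup.ker_mk' K
  have hNn : N.Normal := hW.map _ hsurj
  have hcomm : ⁅N, N⁆ = ⊥ := by
    rw [hN, ← Subgroup.map_commutator, Subgroup.map_eq_bot_iff, hker]
    exact commutator_le_of_chief hKW hmin
  have hNc : IsMulCommutative N := by
    refine ⟨⟨fun a b => Subtype.ext ?_⟩⟩
    have := Subgroup.commutator_mem_commutator a.2 b.2
    rw [hcomm, Subgroup.mem_bot, commutatorElement_eq_one_iff_mul_comm] at this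
    exact this
  have hNbot : N ≠ ⊥ := by
    rw [hN, Ne, Subgroup.map_eq_bot_iff, hker]
    exact hKW.not_ge
  have hcomap : N.comap f = W := by
    rw [hN, Subgroup.comap_map_eq, hker, sup_eq_left.2 hKW.le]
  have hirr : IsIrredAction (conjEnd N) := by
    refine isIrredAction_conjEnd N hNbot fun Z hZ hZN => ?_
    have h1 : Z.comap f < W := by
      rw [← hcomap]
      exact (Subgroup.comap_lt_comap_of_surjective hsurj).2 hZN
    have h2 := hmin (Z.comap f) (hZ.comap f)
      (hker.ge.trans (Subgroup.ker_le_comap f Z)) h1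
    rw [← Subgroup.map_comap_eq_self_of_surjective hsurj Z, h2, Subgroup.map_eq_bot_iff, hker]
  have : Group.IsSolvable (L ⧸ K) := Group.isSolvable_of_surjective hsurj
  have hidx : (conjEnd N).ker.index < n := by
    rw [ker_conjEnd, ← Subgroup.index_comap_of_surjective _ hsurj]
    exact hlt
  have h := (hn (L ⧸ K) (Additive N) (conjEnd N) hirr hidx).comap f
  rw [ker_conjEnd, Subgroup.comap_top] at h
  have hcard : Nat.card (Additive N) = K.relIndex W := by
    change Nat.card N = _
    calc Nat.card N = f.ker.relIndex W := (Subgroup.relIndex_ker W f).symm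
      _ = K.relIndex W := congrArg (fun T : Subgroup L => T.relIndex W) hker
  rwa [hcard] at h

/-- For a solvable permutation group with point stabilizer `M` of index `t`, there is a chain of
normal subgroups down to the kernel `M.normalCore` with abelian factors of order at most `2 ^ t`.
In the primitive case the group modulo the kernel is the semidirect product of a chief factor of
order `t` and a group acting faithfully on that factor. -/
theorem LinearBound.chain_normalCore {n : ℕ} (hn : LinearBound.{u} n) (L : Type u) [Group L]
    [Finite L] [Group.IsSolvable L] (hL : Nat.card L ≤ n) (M : Subgroup L) :
    AbChain (2 ^ M.index) ⊤ M.normalCore := by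
  induction hc : Nat.card L using Nat.strong_induction_on generalizing L with
  | _ c ih =>
  subst hc
  by_cases hM : M = ⊤
  · subst hM
    rw [Subgroup.normalCore_eq_self]
    exact Relation.ReflTransGen.refl
  obtain ⟨M₁, hM₁, hMM₁⟩ := (eq_top_or_exists_le_coatom M).resolve_left hM
  set K := M₁.normalCore with hKdef
  have hKM₁ : K ≤ M₁ := Subgroup.normalCore_le M₁
  have hKtop : K < ⊤ := lt_of_le_of_lt hKM₁ hM₁.lt_top
  obtain ⟨W, hW, hKW, -, hmin⟩ := exists_chief_above hKtop
  have hWab := commutator_le_of_chief hKW hmin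
  have hWM : ¬ W ≤ M₁ := fun h => hKW.not_ge (Subgroup.normal_le_normalCore.2 h)
  have hsup : W ⊔ M₁ = ⊤ := by
    rw [sup_comm]
    exact (hM₁.le_iff.1 le_sup_left).resolve_right fun h => hWM (h ▸ le_sup_right)
  -- Subgroups of `M₁` normalized by both `W` and `M₁` are contained in the kernel.
  have key : ∀ T : Subgroup L, T ≤ M₁ → (∀ w ∈ W, ∀ x ∈ T, w * x * w⁻¹ ∈ T) →
      (∀ m ∈ M₁, ∀ x ∈ T, m * x * m⁻¹ ∈ T) → T ≤ K := by
    intro T hT h1 h2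
    have hTn : T.Normal := by
      refine ⟨fun x hx g => ?_⟩
      have hg : g ∈ W ⊔ M₁ := hsup ▸ Subgroup.mem_top g
      obtain ⟨w, hw, m, hm, rfl⟩ := Subgroup.mem_sup_of_normal_left.1 hg
      have := h1 w hw _ (h2 m hm x hx)
      simpa [mul_assoc] using this
    exact Subgroup.normal_le_normalCore.2 hT
  have hWint : W ⊓ M₁ ≤ K := by
    refine key _ inf_le_right (fun w hw x hx => ?_) fun m hm x hx => ?_
    · have h3 : ⁅w, x⁆ ∈ K := hWab (Subgroup.commutator_mem_commutator hw hx.1)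
      have h4 : w * x * w⁻¹ = ⁅w, x⁆ * x := by group
      rw [h4]
      exact mul_mem (⟨hKW.le h3, hKM₁ h3⟩ : ⁅w, x⁆ ∈ W ⊓ M₁) hx
    · exact ⟨hW.conj_mem x hx.1 m, mul_mem (mul_mem hm hx.2) (M₁.inv_mem hm)⟩
  set C := sectionCentralizer K W with hCdef
  have hCint : C ⊓ M₁ ≤ K := by
    refine key _ inf_le_right (fun w hw x hx => ?_) fun m hm x hx => ?_
    · have h3 : ⁅x, w⁆ ∈ K := mem_sectionCentralizer.1 hx.1 w hw
      have h3' : ⁅w, x⁆ ∈ K := by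
        rw [← commutatorElement_inv]
        exact inv_mem h3
      have h4 : w * x * w⁻¹ = ⁅w, x⁆ * x := by group
      have hKC : K ≤ C := fun k hk => mem_sectionCentralizer.2 fun w hw => by
        have h5 : ⁅k, w⁆ = k * (w * k⁻¹ * w⁻¹) := by group
        rw [h5]
        exact mul_mem hk ((inferInstance : K.Normal).conj_mem _ (inv_mem hk) w)
      rw [h4]
      exact mul_mem (⟨hKC h3', hKM₁ h3'⟩ : ⁅w, x⁆ ∈ C ⊓ M₁) hx
    · exact ⟨(inferInstance : C.Normal).conj_mem x hx.1 m,
        mul_mem (mul_mem hm hx.2) (M₁.inv_mem hm)⟩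
  have hWC : W ≤ C := fun w hw => mem_sectionCentralizer.2 fun w' hw' =>
    hWab (Subgroup.commutator_mem_commutator hw hw')
  have hCW : C = W := by
    refine le_antisymm (fun c hc => ?_) hWC
    have hg : c ∈ W ⊔ M₁ := hsup ▸ Subgroup.mem_top c
    obtain ⟨w, hw, m, hm, rfl⟩ := Subgroup.mem_sup_of_normal_left.1 hg
    have hmC : m ∈ C := by
      have := mul_mem (inv_mem (hWC hw)) hc
      simpa using this
    exact mul_mem hw (hKW.le (hCint ⟨hmC, hm⟩))
  have hindex : K.relIndex W = M₁.index := by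
    have h1 : K = M₁ ⊓ W := le_antisymm (le_inf hKM₁ hKW.le) (inf_comm M₁ W ▸ hWint)
    have h2 := Subgroup.relIndex_mul_index (inf_le_right : M₁ ⊓ W ≤ W)
    have h3 := Subgroup.relIndex_mul_index (inf_le_left : M₁ ⊓ W ≤ M₁)
    have h4 : W.relIndex M₁ = W.index := by
      rw [← Subgroup.relIndex_sup_left M₁ W, hsup, Subgroup.relIndex_top_right]
    rw [Subgroup.inf_relIndex_left, h4, ← h2, ← h1, mul_comm] at h3
    exact (Nat.eq_of_mul_eq_mul_right
      (Nat.pos_of_ne_zero Subgroup.index_ne_zero_of_finite) h3).symm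
  have hM₁pos : M₁.index ≤ 2 ^ M₁.index := Nat.lt_two_pow_self.le
  have hidx : M.index = (M.subgroupOf M₁).index * M₁.index :=
    (Subgroup.relIndex_mul_index hMM₁).symm
  have hM₁le : M₁.index ≤ M.index :=
    Nat.le_of_dvd (Nat.pos_of_ne_zero Subgroup.index_ne_zero_of_finite)
      (Subgroup.index_dvd_of_le hMM₁)
  have c1 : AbChain (2 ^ M.index) ⊤ C := by
    refine (hn.chain_sectionCentralizer hKW hmin ?_).mono ?_
    · refine lt_of_lt_of_le ?_ hL
      rw [← hCdef, hCW]
      have h1 : 1 < Nat.card W :=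
        Subgroup.one_lt_card_iff_ne_bot W |>.2 (ne_bot_of_gt hKW)
      rw [← Subgroup.card_mul_index W]
      have h2 : 0 < W.index := Nat.pos_of_ne_zero Subgroup.index_ne_zero_of_finite
      nlinarith
    · rw [hindex]
      exact hM₁pos.trans (Nat.pow_le_pow_right (by norm_num) hM₁le)
  have c2 : AbChain (2 ^ M.index) C K := by
    rw [hCW]
    refine AbStep.chain ⟨hW, inferInstance, hKW.le, hWab, ?_⟩
    rw [hindex]
    exact hM₁pos.trans (Nat.pow_le_pow_right (by norm_num) hM₁le)
  have c3 : AbChain (2 ^ M.index) K M.normalCore := by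
    have hlt : Nat.card M₁ < Nat.card L := by
      rw [← Subgroup.card_mul_index M₁]
      have h1 : 1 < M₁.index := Subgroup.one_lt_index_of_ne_top hM₁.1
      have h2 : 0 < Nat.card M₁ := Nat.card_pos
      nlinarith
    have h := (ih _ hlt M₁ (hlt.le.trans hL) (M.subgroupOf M₁) rfl).normalCore
    rw [← pow_mul, ← hidx, ← MonoidHom.range_eq_map, Subgroup.range_subtype] at h
    convert h using 1
    refine le_antisymm (Subgroup.normal_le_normalCore.2 fun x hx => ?_)
      (Subgroup.normalCore_mono ?_)
    · have hx' := Subgroup.normalCore_le M hx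
      refine ⟨⟨x, hMM₁ hx'⟩, fun b => ?_, rfl⟩
      exact hx b
    · rintro _ ⟨x, hx, rfl⟩
      exact Subgroup.mem_subgroupOf.1 (Subgroup.normalCore_le _ hx)
  exact (c1.trans c2).trans c3

/-! ### Imprimitive actions -/

theorem card_pow_le_of_iSupIndep {V : Type*} [AddCommGroup V] [Finite V] {ι : Type*} [Finite ι]
    {p : ι → AddSubgroup V} (hp : iSupIndep p) {k : ℕ} (hk : ∀ i, Nat.card (p i) = k) :
    k ^ Nat.card ι ≤ Nat.card V := by
  classical
  let _ : Fintype ι := Fintype.ofFinite ι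
  have h := hp.dfinsuppSumAddHom_injective
  have h1 := Nat.card_le_card_of_injective _
    (h.comp (DFinsupp.equivFunOnFintype (β := fun i => p i)).symm.injective)
  rw [Nat.card_pi, Finset.prod_congr rfl fun i _ => hk i, Finset.prod_const,
    Finset.card_univ, ← Nat.card_eq_fintype_card] at h1
  exact h1

open scoped Pointwise in
/-- If the translates of a proper nonzero subgroup `U` of an irreducible `L`-module `V` are
independent, then the stabilizer `B` of `U` acts irreducibly on `U` and `|U| ^ |L : B| ≤ |V|`. The
chain for the permutation action on the translates is continued by the normal cores of the chain
for the action of `B` on `U`. -/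
theorem LinearBound.chain_of_imprimitive {n : ℕ} (hn : LinearBound.{u} n) {L : Type u} [Group L]
    [Finite L] [Group.IsSolvable L] (hL : Nat.card L ≤ n) {V : Type u} [AddCommGroup V]
    [Finite V] [DistribMulAction L V]
    (hirr : ∀ U : AddSubgroup V, (∀ l : L, ∀ v ∈ U, l • v ∈ U) → U = ⊥ ∨ U = ⊤)
    (hfaith : ∀ l : L, (∀ v : V, l • v = v) → l = 1) (U : AddSubgroup V) (hU : U ≠ ⊥)
    (hU' : U ≠ ⊤)
    (hind : iSupIndep fun W : MulAction.orbit L U => (W : AddSubgroup V)) :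
    AbChain (Nat.card V) (⊤ : Subgroup L) ⊥ := by
  set B := MulAction.stabilizer L U with hB
  have hBU : ∀ b ∈ B, ∀ v ∈ U, b • v ∈ U := by
    intro b hb v hv
    have : b • U = U := hb
    rw [← this]
    exact AddSubgroup.smul_mem_pointwise_smul v b U hv
  have hcardU : 1 < Nat.card U :=
    Finite.one_lt_card_iff_nontrivial.2 ((AddSubgroup.nontrivial_iff_ne_bot U).2 hU)
  have hpow : Nat.card U ^ B.index ≤ Nat.card V := by
    rw [hB, MulAction.index_stabilizer]
    refine card_pow_le_of_iSupIndep hind ?_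
    rintro ⟨_, l, rfl⟩
    exact (Nat.card_congr (U.equivMapOfInjective (DistribSMul.toAddMonoidHom V l)
      (MulAction.injective l)).toEquiv).symm
  have h2pow : 2 ^ B.index ≤ Nat.card V := (Nat.pow_le_pow_left hcardU _).trans hpow
  have hBtop : B ≠ ⊤ := by
    intro h
    have h1 : ∀ l : L, ∀ v ∈ U, l • v ∈ U := fun l => hBU l (h ▸ Subgroup.mem_top l)
    exact (hirr U h1).elim hU hU'
  have hBcard : Nat.card B < Nat.card L := by
    rw [← Subgroup.card_mul_index B]
    have h1 : 1 < B.index := Subgroup.one_lt_index_of_ne_top hBtop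
    have h2 : 0 < Nat.card B := Nat.card_pos
    nlinarith
  let _ : DistribMulAction B U :=
    { smul := fun b v => ⟨b • (v : V), hBU b b.2 v v.2⟩
      one_smul := fun v => Subtype.ext (one_smul L (v : V))
      mul_smul := fun a b v => Subtype.ext (mul_smul (a : L) (b : L) (v : V))
      smul_zero := fun a => Subtype.ext (smul_zero (a : L))
      smul_add := fun a v w => Subtype.ext (smul_add (a : L) (v : V) (w : V)) }
  let ρ : B →* AddEnd U := DistribMulAction.toAddMonoidEnd B U
  have hρ : ∀ b v, ((ρ b v : U) : V) = (b : L) • (v : V) := fun b v => rfl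
  have hirrU : IsIrredAction ρ := by
    refine ⟨(AddSubgroup.nontrivial_iff_ne_bot U).2 hU, fun T hT => ?_⟩
    rw [or_iff_not_imp_left]
    intro hTbot
    set T' := T.map U.subtype with hT'
    have hTU : T' ≤ U := by
      rintro _ ⟨v, -, rfl⟩
      exact v.2
    have hTB : ∀ b ∈ B, ∀ v ∈ T', b • v ∈ T' := by
      rintro b hb _ ⟨v, hv, rfl⟩
      exact ⟨ρ ⟨b, hb⟩ v, hT ⟨b, hb⟩ v hv, rfl⟩
    -- `T'` and the translates of `U` other than `U` together contain all translates of `T'`.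
    set R := ⨆ W : MulAction.orbit L U, ⨆ _ : W ≠ ⟨U, MulAction.mem_orbit_self U⟩,
      (W : AddSubgroup V) with hR
    have hle : ⨆ l : L, l • T' ≤ T' ⊔ R := by
      refine iSup_le fun l => ?_
      by_cases hl : l ∈ B
      · refine le_trans ?_ le_sup_left
        rintro _ ⟨v, hv, rfl⟩
        exact hTB l hl v hv
      · refine le_trans ?_ le_sup_right
        have h1 : l • T' ≤ l • U := by
          rintro _ ⟨v, hv, rfl⟩
          exact ⟨v, hTU hv, rfl⟩
        refine h1.trans ?_
        exact le_iSup₂_of_le (f := fun (W : MulAction.orbit L U)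
          (_ : W ≠ ⟨U, MulAction.mem_orbit_self U⟩) => (W : AddSubgroup V))
          ⟨l • U, MulAction.mem_orbit U l⟩ (fun h => hl (congrArg Subtype.val h)) le_rfl
    have htop : ⨆ l : L, l • T' = ⊤ := by
      refine (hirr _ fun l v hv => ?_).resolve_left fun h => ?_
      · have h1 : l • (⨆ l : L, l • T') ≤ ⨆ l : L, l • T' := by
          refine (AddSubgroup.map_iSup (DistribSMul.toAddMonoidHom V l) _).le.trans ?_
          refine iSup_le fun l' => ?_
          refine le_trans (mul_smul l l' T').ge ?_
          exact le_iSup (fun l : L => l • T') (l * l')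
        exact h1 (AddSubgroup.smul_mem_pointwise_smul v l _ hv)
      · have h1 : T' ≤ ⨆ l : L, l • T' :=
          le_trans (one_smul L T').ge (le_iSup (fun l : L => l • T') 1)
        rw [h, le_bot_iff, hT', AddSubgroup.map_eq_bot_iff_of_injective _ U.subtype_injective]
          at h1
        exact hTbot h1
    have hdis : Disjoint U R := hind ⟨U, MulAction.mem_orbit_self U⟩
    have hUT : U = T' := by
      have h1 : (T' ⊔ R) ⊓ U = T' ⊔ R ⊓ U := sup_inf_assoc_of_le R hTU
      have h2 : T' ⊔ R = ⊤ := by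
        rw [eq_top_iff, ← htop]
        exact hle
      rw [h2, top_inf_eq, hdis.symm.eq_bot, sup_bot_eq] at h1
      exact h1
    rw [eq_top_iff]
    intro v _
    have hv : (v : V) ∈ T' := hUT ▸ v.2
    obtain ⟨w, hw, hwv⟩ := hv
    rwa [← Subtype.ext (show (w : V) = v from hwv)]
  have hker : ρ.ker.index < n := by
    refine lt_of_le_of_lt ?_ (hBcard.trans_le hL)
    exact Nat.le_of_dvd Nat.card_pos (Subgroup.index_dvd_card _)
  have c1 := (hn.chain_normalCore L hL B).mono h2pow
  have c2 := ((hn B U ρ hirrU hker).normalCore).mono hpow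
  rw [← MonoidHom.range_eq_map, Subgroup.range_subtype] at c2
  have hcore : (ρ.ker.map B.subtype).normalCore = ⊥ := by
    rw [eq_bot_iff]
    intro g hg
    rw [Subgroup.mem_bot]
    -- The fixed points of the normal core form an invariant subgroup containing `U`.
    let F : AddSubgroup V :=
      { carrier := {v | ∀ k ∈ (ρ.ker.map B.subtype).normalCore, k • v = v}
        zero_mem' := fun k _ => smul_zero k
        add_mem' := fun {v w} hv hw k hk => by rw [smul_add, hv k hk, hw k hk]
        neg_mem' := fun {v} hv k hk => by rw [smul_neg, hv k hk] }
    have hUF : U ≤ F := by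
      intro v hv k hk
      obtain ⟨b, hb, rfl⟩ := Subgroup.normalCore_le _ hk
      have h1 := hρ b ⟨v, hv⟩
      rw [MonoidHom.mem_ker.1 hb] at h1
      exact h1.symm
    have hF : F = ⊤ := by
      refine (hirr F fun l v hv k hk => ?_).resolve_left fun h => hU (le_bot_iff.1 (h ▸ hUF))
      have h1 := hv _ ((inferInstance : (ρ.ker.map B.subtype).normalCore.Normal).conj_mem k hk l⁻¹)
      rw [inv_inv, mul_smul, mul_smul, inv_smul_eq_iff] at h1
      exact h1
    refine hfaith g fun v => ?_
    have : v ∈ F := hF ▸ AddSubgroup.mem_top v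
    exact this g hg
  rw [hcore] at c2
  exact c1.trans c2

/-! ### Actions in which a maximal abelian normal subgroup acts by scalars -/

/-- For subgroups `A`, `B` that centralize each other, an element `g` with `⁅g, B⁆ ≤ A` and
centralizing `A` gives rise to the homomorphism `b ↦ ⁅g, b⁆` from `B` to `A`. -/
def commutatorHom {G : Type*} [Group G] {A B : Subgroup G}
    (hAB : ∀ a ∈ A, ∀ b ∈ B, a * b = b * a) (g : G) (hg : ∀ b ∈ B, ⁅g, b⁆ ∈ A) : B →* A where
  toFun b := ⟨⁅g, (b : G)⁆, hg b b.2⟩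
  map_one' := Subtype.ext (by simp)
  map_mul' b c := by
    refine Subtype.ext ?_
    have h := hAB _ (hg c c.2) b b.2
    change ⁅g, (b : G) * c⁆ = ⁅g, (b : G)⁆ * ⁅g, (c : G)⁆
    calc ⁅g, (b : G) * c⁆ = ⁅g, (b : G)⁆ * (b * ⁅g, (c : G)⁆) * (b : G)⁻¹ := by
          simp only [commutatorElement_def]; group
      _ = ⁅g, (b : G)⁆ * ⁅g, (c : G)⁆ := by rw [← h]; group

theorem coe_commutatorHom {G : Type*} [Group G] {A B : Subgroup G}
    (hAB : ∀ a ∈ A, ∀ b ∈ B, a * b = b * a) (g : G) (hg : ∀ b ∈ B, ⁅g, b⁆ ∈ A) (b : B) :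
    (commutatorHom hAB g hg b : G) = ⁅g, (b : G)⁆ := rfl

/-- A finite group has at most as many characters with values in a field as it has elements,
because distinct characters are linearly independent. -/
theorem card_monoidHom_field_le (G E : Type*) [Group G] [Finite G] [Field E] [Finite E] :
    Nat.card (G →* E) ≤ Nat.card G := by
  have : Finite (G →* E) := Finite.of_injective _ DFunLike.coe_injective
  let _ := Fintype.ofFinite (G →* E)
  let _ := Fintype.ofFinite G
  have h := (linearIndependent_monoidHom G E).fintype_card_le_finrank
  rwa [Module.finrank_fintype_fun_eq_card, ← Nat.card_eq_fintype_card,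
    ← Nat.card_eq_fintype_card] at h

theorem relIndex_le_card_of_injOn {G S : Type*} [Group G] [Finite S] {H K : Subgroup G}
    (f : K → S) (hf : ∀ x y : K, f x = f y → (x : G)⁻¹ * y ∈ H) : H.relIndex K ≤ Nat.card S := by
  rw [Subgroup.relIndex, Subgroup.index_eq_card]
  refine Nat.card_le_card_of_injective (fun q : K ⧸ H.subgroupOf K => f q.out) fun p q hpq => ?_
  rw [← QuotientGroup.out_eq' p, ← QuotientGroup.out_eq' q, QuotientGroup.eq,
    Subgroup.mem_subgroupOf]
  exact hf _ _ hpq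

theorem sq_le_three_pow (d : ℕ) : d ^ 2 ≤ 3 ^ d := by
  induction d with
  | zero => norm_num
  | succ k ih =>
    rcases Nat.lt_or_ge k 2 with hk | hk
    · interval_cases k <;> norm_num
    · rw [pow_succ 3 k]
      nlinarith

/-- If `A` is the center of a group `B` of class two and acts on `V` by scalars from the field `E`,
then representatives of the cosets of `A` are linearly independent endomorphisms of `V`: conjugation
by `B` acts on them through distinct characters. -/
theorem relIndex_le_finrank_sq {G : Type*} [Group G] {A B : Subgroup G} {E V : Type*} [Field E]
    [AddCommGroup V] [Module E V] (hAleB : A ≤ B) (hAB : ∀ a ∈ A, ∀ b ∈ B, a * b = b * a)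
    (hBB : ∀ b ∈ B, ∀ c ∈ B, ⁅b, c⁆ ∈ A)
    (hZ : ∀ b ∈ B, (∀ c ∈ B, b * c = c * b) → b ∈ A)
    (ρ : B →* Module.End E V) (α : A →* E) (hα : Function.Injective α)
    (hρα : ∀ (a : A) (v : V), ρ ⟨a, hAleB a.2⟩ v = α a • v)
    [Nontrivial V] [FiniteDimensional E V] [Finite B] :
    A.relIndex B ≤ Module.finrank E V ^ 2 := by
  classical
  set Q := B ⧸ A.subgroupOf B with hQ
  let χ : B → B →* E := fun b => (α.comp (commutatorHom hAB (b : G) (hBB b b.2)))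
  -- Conjugating `ρ b` by `ρ c⁻¹` multiplies it by the scalar `χ b c⁻¹`.
  have hχ : ∀ (b c : B) (v : V), ρ b (ρ c v) = χ b c • ρ c (ρ b v) := by
    intro b c v
    have h1 : b * c = ⟨(commutatorHom hAB (b : G) (hBB b b.2) c : G),
        hAleB (Subtype.property _)⟩ * (c * b) := by
      refine Subtype.ext ?_
      change (b : G) * c = ⁅(b : G), (c : G)⁆ * (c * b)
      simp only [commutatorElement_def]
      group
    have h2 := congrArg (fun x => ρ x v) h1
    simp only [map_mul, Module.End.mul_apply] at h2
    rw [h2, hρα]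
    rfl
  have hχinj : Function.Injective fun q : Q => χ q.out := by
    intro p q hpq
    rw [← QuotientGroup.out_eq' p, ← QuotientGroup.out_eq' q, QuotientGroup.eq,
      Subgroup.mem_subgroupOf]
    refine hZ _ (Subtype.property _) fun c hc => ?_
    have h1 := DFunLike.congr_fun hpq ⟨c, hc⟩
    have h2 : ⁅((p.out : B) : G), c⁆ = ⁅((q.out : B) : G), c⁆ := congrArg Subtype.val (hα h1)
    change ((p.out : B) : G)⁻¹ * (q.out : B) * c = c * (((p.out : B) : G)⁻¹ * (q.out : B))
    generalize ((p.out : B) : G) = x at *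
    have hcomm : x * c * x⁻¹ = (q.out : B) * c * ((q.out : B) : G)⁻¹ := by
      have := congrArg (· * c) h2
      simpa [commutatorElement_def] using this
    generalize ((q.out : B) : G) = y at *
    calc x⁻¹ * y * c = x⁻¹ * (y * c * y⁻¹) * y := by group
      _ = c * (x⁻¹ * y) := by rw [← hcomm]; group
  have hind : LinearIndependent E fun q : Q => ρ q.out := by
    have : Finite Q := inferInstance
    let _ := Fintype.ofFinite Q
    rw [Fintype.linearIndependent_iff]
    intro g hg i
    by_contra hgi
    have hchar : LinearIndependent E fun q : Q => (χ q.out : B → E) :=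
      (linearIndependent_monoidHom B E).comp _ hχinj
    rw [Fintype.linearIndependent_iff] at hchar
    have hzero : ∀ (v : V) (f : Module.Dual E V), g i * f (ρ i.out v) = 0 := by
      intro v f
      refine hchar (fun q => g q * f (ρ q.out v)) ?_ i
      funext c
      have h1 := congrArg (fun T : Module.End E V => f (ρ c⁻¹ (T (ρ c v)))) hg
      simp only [LinearMap.sum_apply, LinearMap.smul_apply, map_sum, map_smul, hχ _ c v,
        LinearMap.zero_apply, map_zero] at h1
      simp only [Finset.sum_apply, Pi.smul_apply, Pi.zero_apply, smul_eq_mul]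
      rw [← h1]
      refine Finset.sum_congr rfl fun q _ => ?_
      rw [← Module.End.mul_apply, ← map_mul, inv_mul_cancel, map_one, Module.End.one_apply,
        smul_eq_mul, smul_eq_mul]
      ring
    obtain ⟨v, hv⟩ := exists_ne (0 : V)
    have h1 : ∀ f : Module.Dual E V, f v = 0 := by
      intro f
      have h2 := hzero (ρ (i.out)⁻¹ v) f
      rw [← Module.End.mul_apply, ← map_mul, mul_inv_cancel, map_one, Module.End.one_apply] at h2
      exact (mul_eq_zero.1 h2).resolve_left hgi
    exact hv ((Module.forall_dual_apply_eq_zero_iff E v).1 h1)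
  let _ := Fintype.ofFinite Q
  have h := hind.fintype_card_le_finrank
  rw [Module.finrank_linearMap, ← sq, ← Nat.card_eq_fintype_card] at h
  exact h

theorem relIndex_le_card_module {G : Type*} [Group G] {A B : Subgroup G} {E V : Type*} [Field E]
    [AddCommGroup V] [Module E V] (hAleB : A ≤ B) (hAB : ∀ a ∈ A, ∀ b ∈ B, a * b = b * a)
    (hBB : ∀ b ∈ B, ∀ c ∈ B, ⁅b, c⁆ ∈ A)
    (hZ : ∀ b ∈ B, (∀ c ∈ B, b * c = c * b) → b ∈ A)
    (ρ : B →* Module.End E V) (α : A →* E) (hα : Function.Injective α)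
    (hρα : ∀ (a : A) (v : V), ρ ⟨a, hAleB a.2⟩ v = α a • v)
    [Nontrivial V] [Finite V] [Finite E] [Finite B] :
    A.relIndex B ≤ Nat.card V := by
  have hpos : 1 ≤ Nat.card V := Nat.card_pos
  have : FiniteDimensional E V := Module.Finite.of_finite
  rcases Nat.lt_or_ge (Nat.card E) 3 with hE | hE
  · -- A field with two elements has no nontrivial scalars, so `A` is trivial and `B` abelian.
    have hone : ∀ a ∈ A, a = 1 := by
      intro a ha
      let _ := Fintype.ofFinite E
      have h1 : α ⟨a, ha⟩ ≠ 0 := by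
        intro h
        have h2 : α ⟨a, ha⟩ * α ⟨a, ha⟩⁻¹ = 1 := by rw [← map_mul, mul_inv_cancel, map_one]
        rw [h, zero_mul] at h2
        exact zero_ne_one h2
      have h2 : α ⟨a, ha⟩ = 1 := by
        classical
        by_contra h3
        have h4 := Finset.card_le_univ ({0, 1, α ⟨a, ha⟩} : Finset E)
        rw [Finset.card_eq_three.2 ⟨0, 1, _, zero_ne_one, Ne.symm h1, Ne.symm h3, rfl⟩,
          ← Nat.card_eq_fintype_card] at h4
        omega
      exact congrArg Subtype.val (hα (h2.trans (map_one α).symm))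
    have : B ≤ A := fun b hb => hZ b hb fun c hc =>
      commutatorElement_eq_one_iff_mul_comm.1 (hone _ (hBB b hb c hc))
    rw [Subgroup.relIndex_eq_one.2 this]
    exact hpos
  · calc A.relIndex B ≤ Module.finrank E V ^ 2 :=
          relIndex_le_finrank_sq hAleB hAB hBB hZ ρ α hα hρα
      _ ≤ 3 ^ Module.finrank E V := sq_le_three_pow _
      _ ≤ Nat.card E ^ Module.finrank E V := Nat.pow_le_pow_left hE _
      _ = Nat.card V := (Module.natCard_eq_pow_finrank (K := E)).symm

theorem Subgroup.index_lt_card_of_ne_bot {G : Type*} [Group G] [Finite G] {H : Subgroup G}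
    (hH : H ≠ ⊥) : H.index < Nat.card G := by
  rw [← Subgroup.card_mul_index H]
  have h1 : 1 < Nat.card H := H.one_lt_card_iff_ne_bot.2 hH
  have h2 : 0 < H.index := Nat.pos_of_ne_zero Subgroup.index_ne_zero_of_finite
  nlinarith

theorem conj_inv_mul_eq {G : Type*} [Group G] {x y b : G} (h : x * b * x⁻¹ = y * b * y⁻¹) :
    (x⁻¹ * y) * b * (x⁻¹ * y)⁻¹ = b := by
  calc (x⁻¹ * y) * b * (x⁻¹ * y)⁻¹ = x⁻¹ * (y * b * y⁻¹) * x := by group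
    _ = b := by rw [← h]; group

/-- If `X` centralizes an abelian normal subgroup `A` with a faithful character to a field, then the
elements of `X` centralizing a section `B / A` of `X` act on `B` through characters of `B / A`. -/
theorem abStep_inf_centralizer {L : Type*} [Group L] [Finite L] {A B X : Subgroup L} [A.Normal]
    [hB : B.Normal] [hX : X.Normal] (hAc : ∀ a ∈ A, ∀ b ∈ A, a * b = b * a)
    (hXA : ∀ x ∈ X, ∀ a ∈ A, a * x = x * a) (hBX : B ≤ X) {E : Type*} [Field E] [Finite E]
    (α : A →* E) (hα : Function.Injective α) :
    AbStep (A.relIndex B) (X ⊓ sectionCentralizer A B)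
      (X ⊓ Subgroup.centralizer (B : Set L)) := by
  set T := sectionCentralizer A B with hT
  set Z := Subgroup.centralizer (B : Set L) with hZdef
  have memZ : ∀ {g}, g ∈ Z ↔ ∀ b ∈ B, b * g = g * b :=
    fun {g} => Subgroup.mem_centralizer_iff
  have hAB : ∀ a ∈ A, ∀ b ∈ B, a * b = b * a := fun a ha b hb => hXA b (hBX hb) a ha
  have hg : ∀ g ∈ X ⊓ T, ∀ b ∈ B, ⁅g, b⁆ ∈ A := fun g hg b hb =>
    mem_sectionCentralizer.1 hg.2 b hb
  refine ⟨inferInstance, inferInstance, le_inf inf_le_left ?_, ?_, ?_⟩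
  · intro g hg
    refine mem_sectionCentralizer.2 fun b hb => ?_
    rw [commutatorElement_eq_one_iff_mul_comm.2 (memZ.1 hg.2 b hb).symm]
    exact one_mem A
  · refine le_inf ((Subgroup.commutator_mono inf_le_left inf_le_left).trans
      (Subgroup.commutator_le_left X X)) ?_
    have hprod : ∀ x ∈ X ⊓ T, ∀ y ∈ X ⊓ T, ∀ b ∈ B,
        (x * y) * b * (x * y)⁻¹ = ⁅y, b⁆ * (⁅x, b⁆ * b) := by
      intro x hx y hy b hb
      have h1 := hXA x hx.1 _ (hg y hy b hb)
      calc (x * y) * b * (x * y)⁻¹ = x * ⁅y, b⁆ * b * x⁻¹ := by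
            simp only [commutatorElement_def]; group
        _ = ⁅y, b⁆ * (⁅x, b⁆ * b) := by
            rw [← h1]; simp only [commutatorElement_def]; group
    refine Subgroup.commutator_le.2 fun x hx y hy => memZ.2 fun b hb => ?_
    obtain ⟨b', hb', hbb'⟩ : ∃ b' ∈ B, (y * x) * b' * (y * x)⁻¹ = b :=
      ⟨(y * x)⁻¹ * b * ((y * x)⁻¹)⁻¹, hB.conj_mem b hb _, by group⟩
    have h1 : (x * y) * b' * (x * y)⁻¹ = b := by
      rw [← hbb', hprod x hx y hy b' hb', hprod y hy x hx b' hb', ← mul_assoc, ← mul_assoc,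
        hAc _ (hg y hy b' hb') _ (hg x hx b' hb')]
    have h2 : ⁅x, y⁆ * b * ⁅x, y⁆⁻¹ = (x * y) * b' * (x * y)⁻¹ := by
      rw [← hbb']
      simp only [commutatorElement_def]
      group
    rw [h1] at h2
    exact (mul_inv_eq_iff_eq_mul.1 h2).symm
  · have hker : ∀ g : (X ⊓ T : Subgroup L), A.subgroupOf B ≤
        (α.comp (commutatorHom hAB (g : L) (hg g g.2))).ker := by
      intro g b hb
      have h1 : ⁅(g : L), (b : L)⁆ = 1 := commutatorElement_eq_one_iff_mul_comm.2
        (hXA g g.2.1 b hb).symm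
      have h2 : commutatorHom hAB (g : L) (hg g g.2) b = 1 := Subtype.ext h1
      rw [MonoidHom.mem_ker, MonoidHom.comp_apply, h2, map_one]
    let f : (X ⊓ T : Subgroup L) → (B ⧸ A.subgroupOf B →* E) := fun g =>
      QuotientGroup.lift _ (α.comp (commutatorHom hAB (g : L) (hg g g.2))) (hker g)
    have hf : ∀ (g : (X ⊓ T : Subgroup L)) (b : B),
        f g (QuotientGroup.mk b) = α (commutatorHom hAB (g : L) (hg g g.2) b) :=
      fun g b => rfl
    have : Finite (B ⧸ A.subgroupOf B →* E) := Finite.of_injective _ DFunLike.coe_injective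
    have hle : (X ⊓ Z).relIndex (X ⊓ T) ≤ Nat.card (B ⧸ A.subgroupOf B →* E) := by
      refine relIndex_le_card_of_injOn f fun x y hxy =>
        ⟨X.mul_mem (X.inv_mem x.2.1) y.2.1, ?_⟩
      refine memZ.2 fun b hb => ?_
      have h1 := hα ((hf x ⟨b, hb⟩).symm.trans ((congrArg (fun t : B ⧸ A.subgroupOf B →* E =>
        t (QuotientGroup.mk ⟨b, hb⟩)) hxy).trans (hf y ⟨b, hb⟩)))
      have h2 := congrArg Subtype.val h1
      rw [coe_commutatorHom, coe_commutatorHom] at h2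
      have h3 : (x : L) * b * (x : L)⁻¹ = y * b * (y : L)⁻¹ := by
        have := congrArg (· * b) h2
        simpa [commutatorElement_def] using this
      exact (mul_inv_eq_iff_eq_mul.1 (conj_inv_mul_eq h3)).symm
    exact hle.trans (card_monoidHom_field_le _ _)

/-- A group modulo the centralizer of a cyclic normal subgroup `A` is abelian of order at most
`|A|`. -/
theorem abStep_top_centralizer {L : Type*} [Group L] [Finite L] {A : Subgroup L}
    [hA : A.Normal] (hcyc : IsCyclic A) :
    AbStep (Nat.card A) ⊤ (Subgroup.centralizer (A : Set L)) := by
  obtain ⟨⟨a₀, ha₀⟩, hgen⟩ := hcyc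
  have hconj : ∀ g : L, ∃ k : ℤ, g * a₀ * g⁻¹ = a₀ ^ k := by
    intro g
    obtain ⟨k, hk⟩ := hgen ⟨g * a₀ * g⁻¹, hA.conj_mem a₀ ha₀ g⟩
    exact ⟨k, (congrArg Subtype.val hk).symm⟩
  have hcent : ∀ g : L, g * a₀ * g⁻¹ = a₀ → g ∈ Subgroup.centralizer (A : Set L) := by
    intro g hg
    refine Subgroup.mem_centralizer_iff.2 fun a ha => ?_
    obtain ⟨k, hk⟩ := hgen ⟨a, ha⟩
    have hk' : a₀ ^ k = a := congrArg Subtype.val hk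
    have h1 : g * a₀ ^ k * g⁻¹ = a₀ ^ k := by rw [← conj_zpow, hg]
    rw [← hk']
    exact (mul_inv_eq_iff_eq_mul.1 h1).symm
  refine ⟨inferInstance, inferInstance, le_top, ?_, ?_⟩
  · refine Subgroup.commutator_le.2 fun g _ h _ => hcent _ ?_
    have key : ∀ x y : L, (x * y) * a₀ * (x * y)⁻¹ = (y * x) * a₀ * (y * x)⁻¹ := by
      intro x y
      obtain ⟨k, hk⟩ := hconj x
      obtain ⟨m, hm⟩ := hconj y
      calc (x * y) * a₀ * (x * y)⁻¹ = x * (y * a₀ * y⁻¹) * x⁻¹ := by group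
        _ = (a₀ ^ k) ^ m := by rw [hm, ← conj_zpow, hk]
        _ = (a₀ ^ m) ^ k := by rw [← zpow_mul, ← zpow_mul, mul_comm]
        _ = y * (x * a₀ * x⁻¹) * y⁻¹ := by rw [hk, ← conj_zpow, hm]
        _ = (y * x) * a₀ * (y * x)⁻¹ := by group
    calc ⁅g, h⁆ * a₀ * ⁅g, h⁆⁻¹
        = (g * h) * ((g⁻¹ * h⁻¹) * a₀ * (g⁻¹ * h⁻¹)⁻¹) * (g * h)⁻¹ := by
          simp only [commutatorElement_def]; group
      _ = a₀ := by rw [key g⁻¹ h⁻¹]; group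
  · refine (relIndex_le_card_of_injOn (S := A)
      (fun x : (⊤ : Subgroup L) => ⟨x * a₀ * (x : L)⁻¹, hA.conj_mem a₀ ha₀ _⟩)
      fun x y hxy => hcent _ (conj_inv_mul_eq (congrArg Subtype.val hxy)))

/-- Suppose a maximal abelian normal subgroup `A` acts on `V` by scalars from a field `E` over which
the centralizer `C` of `A` acts linearly. Then `A` is cyclic, so `L / C` is abelian, and the factors
between `C` and `A` are controlled by chief factors `B / A`, for which `A` is the center of `B`. -/
theorem LinearBound.chain_of_scalar {n : ℕ} (hn : LinearBound.{u} n) {L : Type u} [Group L]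
    [Finite L] [Group.IsSolvable L] (hL : Nat.card L ≤ n) {E V : Type*} [Field E] [Finite E]
    [AddCommGroup V] [Finite V] [Nontrivial V] [Module E V] (σ : L →* AddEnd V)
    (hσ : Function.Injective σ) (A : Subgroup L) [hA : A.Normal]
    (hAc : ∀ a ∈ A, ∀ b ∈ A, a * b = b * a)
    (hmax : ∀ N : Subgroup L, N.Normal → A ≤ N → (∀ x ∈ N, ∀ y ∈ N, x * y = y * x) → N ≤ A)
    (hscal : ∀ a ∈ A, ∃ c : E, ∀ v, σ a v = c • v)
    (hlin : ∀ g ∈ Subgroup.centralizer (A : Set L), ∀ (c : E) (v : V),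
      σ g (c • v) = c • σ g v) :
    AbChain (Nat.card V) (⊤ : Subgroup L) ⊥ := by
  obtain ⟨v₀, hv₀⟩ := exists_ne (0 : V)
  have hEV : Nat.card E ≤ Nat.card V :=
    Nat.card_le_card_of_injective _ (smul_left_injective E hv₀)
  choose c hc using fun a : A => hscal a a.2
  let α : A →* E :=
    { toFun := c
      map_one' := smul_left_injective E hv₀ (by
        change c 1 • v₀ = (1 : E) • v₀
        rw [← hc, one_smul, Subgroup.coe_one, map_one]
        rfl)
      map_mul' := fun a b => smul_left_injective E hv₀ (by
        change c (a * b) • v₀ = (c a * c b) • v₀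
        rw [← hc, Subgroup.coe_mul, map_mul, mul_smul, ← hc, ← hc]
        rfl) }
  have hα : Function.Injective α := by
    intro a b hab
    refine Subtype.ext (hσ (AddMonoidHom.ext fun v => ?_))
    exact (hc a v).trans ((congrArg (· • v) hab).trans (hc b v).symm)
  have hAcard : Nat.card A ≤ Nat.card V := (Nat.card_le_card_of_injective _ hα).trans hEV
  set C := Subgroup.centralizer (A : Set L) with hC
  have memC : ∀ {g}, g ∈ C ↔ ∀ a ∈ A, a * g = g * a := fun {g} => Subgroup.mem_centralizer_iff
  have hAC : A ≤ C := fun a ha => memC.2 fun b hb => hAc b hb a ha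
  have hbotA : AbStep (Nat.card V) A ⊥ := by
    refine ⟨hA, inferInstance, bot_le, ?_, by rwa [Subgroup.relIndex_bot_left]⟩
    refine Subgroup.commutator_le.2 fun a ha b hb => ?_
    rw [Subgroup.mem_bot, commutatorElement_eq_one_iff_mul_comm]
    exact hAc a ha b hb
  have htopC : AbStep (Nat.card V) ⊤ C :=
    (abStep_top_centralizer (isCyclic_of_injective_ringHom α hα)).mono hAcard
  have main : ∀ m : ℕ, ∀ X : Subgroup L, X.Normal → A ≤ X → X ≤ C → Nat.card X = m →
      AbChain (Nat.card V) X A := by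
    intro m
    induction m using Nat.strong_induction_on with
    | _ m ih =>
    intro X hX hAX hXC hm
    rcases hAX.lt_or_eq with hlt | heq
    swap
    · rw [heq]
      exact Relation.ReflTransGen.refl
    obtain ⟨B, hB, hAltB, hBX, hmin⟩ := exists_chief_above hlt
    have hBC : B ≤ C := hBX.trans hXC
    have hBcomm := commutator_le_of_chief hAltB hmin
    have hAB : ∀ a ∈ A, ∀ b ∈ B, a * b = b * a := fun a ha b hb => memC.1 (hBC hb) a ha
    have hBB : ∀ b ∈ B, ∀ c ∈ B, ⁅b, c⁆ ∈ A := fun b hb c hc =>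
      hBcomm (Subgroup.commutator_mem_commutator hb hc)
    set Z := Subgroup.centralizer (B : Set L) with hZdef
    have memZ : ∀ {g}, g ∈ Z ↔ ∀ b ∈ B, b * g = g * b :=
      fun {g} => Subgroup.mem_centralizer_iff
    have hAZ : A ≤ Z := fun a ha => memZ.2 fun b hb => (hAB a ha b hb).symm
    have hZ : ∀ b ∈ B, (∀ c ∈ B, b * c = c * b) → b ∈ A := by
      intro b hb h
      refine hmax (B ⊓ Z) inferInstance (le_inf hAltB.le hAZ) (fun x hx y hy => ?_)
        ⟨hb, memZ.2 fun c hc => (h c hc).symm⟩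
      exact memZ.1 hy.2 x hx.1
    have hidx : A.relIndex B ≤ Nat.card V := by
      let ρ : B →* Module.End E V :=
        { toFun := fun b =>
            { toFun := σ b
              map_add' := map_add (σ b)
              map_smul' := hlin b (hBC b.2) }
          map_one' := LinearMap.ext fun v => congrArg (fun T : AddEnd V => T v) (map_one σ)
          map_mul' := fun a b =>
            LinearMap.ext fun v => congrArg (fun T : AddEnd V => T v) (map_mul σ (a : L) b) }
      exact relIndex_le_card_module hAltB.le hAB hBB hZ ρ α hα fun a v => hc a v
    set T := sectionCentralizer A B with hT
    have hBT : B ≤ T := fun b hb => mem_sectionCentralizer.2 fun c hc => hBB b hb c hc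
    have hTlt : T.index < n :=
      (Subgroup.index_lt_card_of_ne_bot (ne_bot_of_gt (hAltB.trans_le hBT))).trans_le hL
    have c1 : AbChain (Nat.card V) X (X ⊓ T) := by
      have h := ((hn.chain_sectionCentralizer hAltB hmin hTlt).mono hidx).inf X
      rwa [top_inf_eq, inf_comm] at h
    have c2 : AbStep (Nat.card V) (X ⊓ T) (X ⊓ Z) :=
      (abStep_inf_centralizer hAc (fun x hx a ha => memC.1 (hXC hx) a ha) hBX α hα).mono hidx
    have hlt' : X ⊓ Z < X := by
      refine lt_of_le_of_ne inf_le_left fun h => hAltB.not_ge ?_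
      have hBZ : B ≤ Z := hBX.trans (inf_eq_left.1 h)
      exact fun b hb => hZ b hb fun c hc => memZ.1 (hBZ hc) b hb
    have hcardlt : Nat.card (X ⊓ Z : Subgroup L) < m := by
      rw [← hm]
      exact Set.Finite.card_lt_card (Set.toFinite _) hlt'
    exact (c1.trans c2.chain).trans
      (ih _ hcardlt (X ⊓ Z) inferInstance (le_inf hAX hAZ) (inf_le_left.trans hXC) rfl)
  exact (htopC.chain.trans (main _ C inferInstance hAC le_rfl rfl)).trans hbotA.chain

/-! ### Chief series of solvable linear groups -/

theorem iSupIndep_toAddSubgroup {R M ι : Type*} [Ring R] [AddCommGroup M] [Module R M]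
    {p : ι → Submodule R M} (hp : iSupIndep p) : iSupIndep fun i => (p i).toAddSubgroup := by
  classical
  exact iSupIndep_of_dfinsuppSumAddHom_injective' _ hp.dfinsupp_lsum_injective

open scoped Pointwise in
/-- Let `S` be a finite commutative ring of endomorphisms of the irreducible `L`-module `V`,
normalized by `L`, and let `m` be a maximal ideal of `S` annihilating some simple submodule. The
translates of the `m`-torsion `V[m]` are the torsion subgroups of the conjugates of `m`, so they are
independent. Either they form a system of imprimitivity, or `V[m] = V` and `S` acts through the
field `S / m`. -/
theorem LinearBound.chain_of_commRing {n : ℕ} (hn : LinearBound.{u} n) {L : Type u} [Group L]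
    [Finite L] [Group.IsSolvable L] (hL : Nat.card L ≤ n) {V : Type u} [AddCommGroup V]
    [Finite V] (σ : L →* AddEnd V) (hirr : IsIrredAction σ) (hσ : Function.Injective σ)
    (A : Subgroup L) [hA : A.Normal] (hAc : ∀ a ∈ A, ∀ b ∈ A, a * b = b * a)
    (hmax : ∀ N : Subgroup L, N.Normal → A ≤ N → (∀ x ∈ N, ∀ y ∈ N, x * y = y * x) → N ≤ A)
    {S : Type*} [CommRing S] [Finite S] [Module S V] (τ : L → S ≃+* S)
    (hτ : ∀ l s v, σ l (s • v) = τ l s • σ l v)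
    (hscal : ∀ a ∈ A, ∃ c : S, ∀ v : V, σ a v = c • v)
    (hlin : ∀ g ∈ Subgroup.centralizer (A : Set L), ∀ (c : S) (v : V),
      σ g (c • v) = c • σ g v) :
    AbChain (Nat.card V) (⊤ : Subgroup L) ⊥ := by
  have hVnt : Nontrivial V := hirr.1
  obtain ⟨P, hP, -⟩ := (eq_bot_or_exists_atom_le (⊤ : Submodule S V)).resolve_left top_ne_bot
  have hPs : IsSimpleModule S P := isSimpleModule_iff_isAtom.2 hP
  set m := Module.annihilator S P with hm
  have hmmax : m.IsMaximal := IsSimpleModule.annihilator_isMaximal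
  let tors : Ideal S → AddSubgroup V := fun I => (Submodule.torsionBySet S V I).toAddSubgroup
  have mem_tors : ∀ (I : Ideal S) (v : V), v ∈ tors I ↔ ∀ s ∈ I, s • v = 0 := by
    intro I v
    change v ∈ Submodule.torsionBySet S V I ↔ _
    rw [Submodule.mem_torsionBySet_iff]
    exact Subtype.forall
  have hPU : P.toAddSubgroup ≤ tors m := by
    intro v hv
    refine (mem_tors m v).2 fun s hs => ?_
    exact congrArg Subtype.val (Module.mem_annihilator.1 hs ⟨v, hv⟩)
  have hUbot : tors m ≠ ⊥ := by
    intro h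
    rw [h, le_bot_iff] at hPU
    refine hP.1 ?_
    rw [eq_bot_iff]
    intro v hv
    have : v ∈ P.toAddSubgroup := hv
    rw [hPU] at this
    exact this
  by_cases hUtop : tors m = ⊤
  · -- `S` acts on `V` through its residue field.
    have htor : Module.IsTorsionBySet S V (m : Set S) := fun v s =>
      (mem_tors m v).1 (hUtop ▸ AddSubgroup.mem_top v) s s.2
    have : Finite (S ⧸ m) := Finite.of_surjective _ Ideal.Quotient.mk_surjective
    let _ : Field (S ⧸ m) := Ideal.Quotient.field m
    let _ : Module (S ⧸ m) V := htor.module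
    have hmk : ∀ (s : S) (v : V), Ideal.Quotient.mk m s • v = s • v := fun s v => htor.mk_smul s v
    refine hn.chain_of_scalar hL (E := S ⧸ m) σ hσ A hAc hmax (fun a ha => ?_) fun g hg c v => ?_
    · obtain ⟨c, hc⟩ := hscal a ha
      exact ⟨Ideal.Quotient.mk m c, fun v => (hc v).trans (hmk c v).symm⟩
    · obtain ⟨s, rfl⟩ := Ideal.Quotient.mk_surjective c
      rw [hmk, hmk]
      exact hlin g hg s v
  · let _ : DistribMulAction L V := DistribMulAction.compHom V σ
    have hsmul : ∀ (l : L) (v : V), l • v = σ l v := fun l v => rfl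
    refine hn.chain_of_imprimitive hL hirr.2 (fun l hl => hσ ?_) (tors m) hUbot hUtop ?_
    · rw [map_one]
      exact AddMonoidHom.ext hl
    have horb : ∀ W : MulAction.orbit L (tors m), ∃ I : Ideal S, I.IsMaximal ∧
        tors I = (W : AddSubgroup V) := by
      rintro ⟨_, l, rfl⟩
      refine ⟨m.comap (τ l⁻¹), inferInstance, ?_⟩
      ext v
      rw [mem_tors]
      change _ ↔ v ∈ l • tors m
      rw [AddSubgroup.mem_pointwise_smul_iff_inv_smul_mem, mem_tors]
      constructor
      · intro h s hs
        obtain ⟨t, rfl⟩ := (τ l⁻¹).surjective s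
        have h1 : σ l⁻¹ (t • v) = τ l⁻¹ t • l⁻¹ • v := hτ l⁻¹ t v
        rw [← h1, h t hs, map_zero]
      · intro h s hs
        have h1 : l⁻¹ • (s • v) = τ l⁻¹ s • l⁻¹ • v := hτ l⁻¹ s v
        rw [h _ hs, smul_eq_zero_iff_eq] at h1
        exact h1
    choose I hImax hI using horb
    have hind : iSupIndep fun W => Submodule.torsionBySet S V (I W) := by
      let _ := Fintype.ofFinite (MulAction.orbit L (tors m))
      rw [iSupIndep_iff_supIndep_univ]
      refine Submodule.supIndep_torsionBySet_ideal fun W _ W' _ hne => ?_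
      refine (hImax W).coprime_of_ne (hImax W') fun h => hne (Subtype.ext ?_)
      rw [← hI W, ← hI W', h]
    have h := iSupIndep_toAddSubgroup hind
    have heq : (fun W : MulAction.orbit L (tors m) => (W : AddSubgroup V)) =
        fun W => (Submodule.torsionBySet S V (I W)).toAddSubgroup :=
      funext fun W => (hI W).symm
    rw [heq]
    exact h

/-- The linear bound for faithful actions; the commutative ring is generated by a maximal abelian
normal subgroup. -/
theorem LinearBound.chain_of_faithful {n : ℕ} (hn : LinearBound.{u} n) {L : Type u} [Group L]
    [Finite L] [Group.IsSolvable L] (hL : Nat.card L ≤ n) {V : Type u} [AddCommGroup V]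
    [Finite V] (σ : L →* AddEnd V) (hirr : IsIrredAction σ) (hσ : Function.Injective σ) :
    AbChain (Nat.card V) (⊤ : Subgroup L) ⊥ := by
  obtain ⟨A, -, hAmax⟩ := (Set.toFinite {N : Subgroup L | N.Normal ∧
    ∀ x ∈ N, ∀ y ∈ N, x * y = y * x}).exists_le_maximal (a := ⊥) ⟨inferInstance, by
      intro x hx y hy
      rw [Subgroup.mem_bot.1 hx, Subgroup.mem_bot.1 hy]⟩
  have hA : A.Normal := hAmax.prop.1
  have hAc := hAmax.prop.2
  set S := Subring.closure (σ '' (A : Set L)) with hS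
  have hScomm : IsMulCommutative S := by
    refine Subring.isMulCommutative_closure ?_
    rintro _ ⟨a, ha, rfl⟩ _ ⟨b, hb, rfl⟩
    rw [← map_mul, ← map_mul, hAc a ha b hb]
  have : Finite (AddEnd V) := Finite.of_injective (fun f : AddEnd V => (f : V → V))
    DFunLike.coe_injective
  have hcancel : ∀ (l : L) (f : AddEnd V), σ l * (σ l⁻¹ * f * σ l) * σ l⁻¹ = f := by
    intro l f
    have h1 : σ l * σ l⁻¹ = 1 := by rw [← map_mul, mul_inv_cancel, map_one]
    rw [← mul_assoc, ← mul_assoc, h1, one_mul, mul_assoc, h1, mul_one]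
  have hconj : ∀ (l : L) (f : AddEnd V), f ∈ S → σ l * f * σ l⁻¹ ∈ S := by
    intro l f hf
    have h1 : σ l⁻¹ * σ l = 1 := by rw [← map_mul, inv_mul_cancel, map_one]
    have h2 : σ l * σ l⁻¹ = 1 := by rw [← map_mul, mul_inv_cancel, map_one]
    induction hf using Subring.closure_induction with
    | mem x hx =>
      obtain ⟨a, ha, rfl⟩ := hx
      rw [← map_mul, ← map_mul]
      exact Subring.subset_closure ⟨_, hA.conj_mem a ha l, rfl⟩
    | zero => rw [mul_zero, zero_mul]; exact S.zero_mem
    | one => rw [mul_one, h2]; exact S.one_mem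
    | add x y _ _ hx hy => rw [mul_add, add_mul]; exact S.add_mem hx hy
    | neg x _ hx => rw [mul_neg, neg_mul]; exact S.neg_mem hx
    | mul x y _ _ hx hy =>
      have h3 : σ l * (x * y) * σ l⁻¹ = (σ l * x * σ l⁻¹) * (σ l * y * σ l⁻¹) := by
        calc σ l * (x * y) * σ l⁻¹ = σ l * x * 1 * (y * σ l⁻¹) := by
              rw [mul_one]; simp only [mul_assoc]
          _ = _ := by rw [← h1]; simp only [mul_assoc]
      rw [h3]
      exact S.mul_mem hx hy
  let τ : L → S ≃+* S := fun l =>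
    { toFun := fun s => ⟨σ l * s * σ l⁻¹, hconj l s s.2⟩
      invFun := fun s => ⟨σ l⁻¹ * s * σ l, by simpa using hconj l⁻¹ s s.2⟩
      left_inv := fun s => Subtype.ext (by simpa using hcancel l⁻¹ (s : AddEnd V))
      right_inv := fun s => Subtype.ext (hcancel l s)
      map_add' := fun s t => Subtype.ext (by
        change σ l * ((s : AddEnd V) + t) * σ l⁻¹ = _
        rw [mul_add, add_mul]; rfl)
      map_mul' := fun s t => Subtype.ext (by
        have h1 : σ l⁻¹ * σ l = 1 := by rw [← map_mul, inv_mul_cancel, map_one]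
        change σ l * ((s : AddEnd V) * t) * σ l⁻¹ =
          (σ l * (s : AddEnd V) * σ l⁻¹) * (σ l * (t : AddEnd V) * σ l⁻¹)
        calc σ l * ((s : AddEnd V) * t) * σ l⁻¹ = σ l * s * 1 * (t * σ l⁻¹) := by
              rw [mul_one]; simp only [mul_assoc]
          _ = _ := by rw [← h1]; simp only [mul_assoc]) }
  refine hn.chain_of_commRing hL σ hirr hσ A hAc
    (fun N hN hAN hNc => hAmax.le_of_ge ⟨hN, hNc⟩ hAN) (S := S) τ (fun l s v => ?_)
    (fun a ha => ⟨⟨σ a, Subring.subset_closure ⟨a, ha, rfl⟩⟩, fun v => rfl⟩) fun g hg c v => ?_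
  · change σ l ((s : AddEnd V) v) = σ l ((s : AddEnd V) (σ l⁻¹ (σ l v)))
    have h1 : σ l⁻¹ (σ l v) = v := by
      change (σ l⁻¹ * σ l) v = v
      rw [← map_mul, inv_mul_cancel, map_one]
      rfl
    rw [h1]
  · have h1 : (c : AddEnd V) ∈ Subring.centralizer {σ g} := by
      refine (Subring.closure_le.2 ?_) c.2
      rintro _ ⟨a, ha, rfl⟩
      refine Subring.mem_centralizer_iff.2 ?_
      rintro _ rfl
      rw [← map_mul, ← map_mul, Subgroup.mem_centralizer_iff.1 hg a ha]
    have h2 := Subring.mem_centralizer_iff.1 h1 (σ g) rfl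
    exact congrArg (fun f : AddEnd V => f v) h2

/-- A finite solvable group with an irreducible action on `V` has a chain of normal subgroups down
to the kernel of the action with abelian factors of order at most `|V|`. -/
theorem linearBound (n : ℕ) : LinearBound.{u} n := by
  induction n with
  | zero => exact fun L _ _ _ V _ _ ρ _ h => absurd h (Nat.not_lt_zero _)
  | succ n ih =>
    intro L _ _ _ V _ _ ρ hirr hlt
    let σ : L ⧸ ρ.ker →* AddEnd V := QuotientGroup.lift ρ.ker ρ le_rfl
    have hσ : Function.Injective σ := by
      intro x y
      induction x using QuotientGroup.induction_on with | H x =>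
      induction y using QuotientGroup.induction_on with | H y =>
      intro hxy
      have h1 : ρ x = ρ y := hxy
      rw [QuotientGroup.eq, MonoidHom.mem_ker, map_mul, ← h1, ← map_mul, inv_mul_cancel, map_one]
    have hσirr : IsIrredAction σ := ⟨hirr.1, fun U hU => hirr.2 U fun l => hU l⟩
    have : Group.IsSolvable (L ⧸ ρ.ker) :=
      Group.isSolvable_of_surjective (QuotientGroup.mk'_surjective ρ.ker)
    have hcard : Nat.card (L ⧸ ρ.ker) ≤ n := Nat.le_of_lt_succ hlt
    have h := (ih.chain_of_faithful hcard σ hσirr hσ).comap (QuotientGroup.mk' ρ.ker)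
    rwa [Subgroup.comap_top, MonoidHom.comap_bot, QuotientGroup.ker_mk'] at h

/-- Every chief factor `W / K` of a finite solvable group `L` admits a chain of normal subgroups
from `L` down to its centralizer with abelian factors of order at most `|W / K|`. -/
theorem abChain_sectionCentralizer {L : Type*} [Group L] [Finite L] [Group.IsSolvable L]
    {K W : Subgroup L} [K.Normal] [W.Normal] (hKW : K < W)
    (hmin : ∀ Z : Subgroup L, Z.Normal → K ≤ Z → Z < W → Z = K) :
    AbChain (K.relIndex W) ⊤ (sectionCentralizer K W) :=
  (linearBound _).chain_sectionCentralizer hKW hmin (Nat.lt_succ_self _)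

/-! ### Covers of quotients -/

theorem IsSubgroupCover.groupSum_le {G : Type*} [Group G] {F : Set (Subgroup G)}
    (hF : IsSubgroupCover G F) : groupSum G ≤ F.encard :=
  sInf_le ⟨F, hF, rfl⟩

theorem le_groupSum {G : Type*} [Group G] {k : ℕ∞}
    (h : ∀ F : Set (Subgroup G), IsSubgroupCover G F → k ≤ F.encard) : k ≤ groupSum G := by
  refine le_sInf ?_
  rintro _ ⟨F, hF, rfl⟩
  exact h F hF

theorem groupSum_le_of_surjective {G H : Type*} [Group G] [Group H] (f : G →* H)
    (hf : Function.Surjective f) : groupSum G ≤ groupSum H := by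
  refine le_groupSum fun F hF => ?_
  have h : IsSubgroupCover G (Subgroup.comap f '' F) := by
    refine ⟨?_, fun g => ?_⟩
    · rintro _ ⟨K, hK, rfl⟩ htop
      refine hF.1 K hK ?_
      rw [← Subgroup.map_comap_eq_self_of_surjective hf K, htop,
        Subgroup.map_top_of_surjective f hf]
    · obtain ⟨K, hK, hg⟩ := hF.2 (f g)
      exact ⟨_, ⟨K, hK, rfl⟩, hg⟩
  exact h.groupSum_le.trans (Set.encard_image_le _ _)

theorem groupSum_quotient_le_of_le {G : Type*} [Group G] {X Y : Subgroup G} [X.Normal] [Y.Normal]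
    (hYX : Y ≤ X) : groupSum (G ⧸ Y) ≤ groupSum (G ⧸ X) :=
  groupSum_le_of_surjective (QuotientGroup.map Y X (MonoidHom.id G) hYX)
    (QuotientGroup.map_surjective_of_surjective Y X (MonoidHom.id G)
      QuotientGroup.mk_surjective hYX)

/-- A cover by subgroups containing `N` induces a cover of `G / N`. -/
theorem IsSubgroupCover.groupSum_quotient_le {G : Type*} [Group G] {F : Set (Subgroup G)}
    (hF : IsSubgroupCover G F) (N : Subgroup G) [N.Normal] (hN : ∀ H ∈ F, N ≤ H) :
    groupSum (G ⧸ N) ≤ F.encard := by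
  have h : IsSubgroupCover (G ⧸ N) (Subgroup.map (QuotientGroup.mk' N) '' F) := by
    refine ⟨?_, fun g => ?_⟩
    · rintro _ ⟨K, hK, rfl⟩ htop
      refine hF.1 K hK ?_
      have h1 := congrArg (Subgroup.comap (QuotientGroup.mk' N)) htop
      rwa [Subgroup.comap_map_eq, QuotientGroup.ker_mk', sup_eq_left.2 (hN K hK),
        Subgroup.comap_top] at h1
    · obtain ⟨x, rfl⟩ := QuotientGroup.mk'_surjective N g
      obtain ⟨K, hK, hx⟩ := hF.2 x
      exact ⟨_, ⟨K, hK, rfl⟩, x, hx, rfl⟩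
  exact h.groupSum_le.trans (Set.encard_image_le _ _)

theorem isCyclic_quotient_iff {G : Type*} [Group G] (X : Subgroup G) [X.Normal] :
    IsCyclic (G ⧸ X) ↔ ∃ x : G, ∀ g : G, ∃ k : ℤ, (x ^ k)⁻¹ * g ∈ X := by
  constructor
  · rintro ⟨x, hx⟩
    obtain ⟨x, rfl⟩ := QuotientGroup.mk_surjective x
    refine ⟨x, fun g => ?_⟩
    obtain ⟨k, hk⟩ := hx g
    refine ⟨k, QuotientGroup.eq.1 ?_⟩
    rw [QuotientGroup.mk_zpow]
    exact hk
  · rintro ⟨x, hx⟩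
    refine ⟨x, fun g => ?_⟩
    obtain ⟨g, rfl⟩ := QuotientGroup.mk_surjective g
    obtain ⟨k, hk⟩ := hx g
    refine ⟨k, ?_⟩
    change (x : G ⧸ X) ^ k = g
    rw [← QuotientGroup.mk_zpow]
    exact QuotientGroup.eq.2 hk

theorem isCyclic_of_quotient_bot {G : Type*} [Group G] (h : IsCyclic (G ⧸ (⊥ : Subgroup G))) :
    IsCyclic G := by
  obtain ⟨x, hx⟩ := (isCyclic_quotient_iff ⊥).1 h
  refine ⟨x, fun g => ?_⟩
  obtain ⟨k, hk⟩ := hx g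
  exact ⟨k, inv_mul_eq_one.1 (Subgroup.mem_bot.1 hk)⟩

theorem isCyclic_quotient_of_le {G : Type*} [Group G] {X Y : Subgroup G} [X.Normal] [Y.Normal]
    (hXY : X ≤ Y) (h : IsCyclic (G ⧸ X)) : IsCyclic (G ⧸ Y) := by
  obtain ⟨x, hx⟩ := (isCyclic_quotient_iff X).1 h
  exact (isCyclic_quotient_iff Y).2 ⟨x, fun g => (hx g).imp fun k hk => hXY hk⟩

theorem isCyclic_quotient_map {G : Type*} [Group G] {D K : Subgroup G} [K.Normal] [D.Normal]
    [(D.map (QuotientGroup.mk' K)).Normal] (h : IsCyclic (G ⧸ D)) :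
    IsCyclic ((G ⧸ K) ⧸ D.map (QuotientGroup.mk' K)) := by
  obtain ⟨x, hx⟩ := (isCyclic_quotient_iff D).1 h
  refine (isCyclic_quotient_iff _).2 ⟨QuotientGroup.mk' K x, fun g => ?_⟩
  obtain ⟨g, rfl⟩ := QuotientGroup.mk'_surjective K g
  obtain ⟨k, hk⟩ := hx g
  exact ⟨k, _, hk, by rw [map_mul, map_inv, map_zpow]⟩

/-! ### Groups all of whose proper quotients are cyclic -/

section Critical

variable {G : Type*} [Group G] [Finite G] {N : Subgroup G}

/-- In a nonabelian group with all proper quotients cyclic, let `x` generate the group modulo a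
minimal normal abelian subgroup `N`. A power of `x` outside `N` is not central, so it commutes with
no nontrivial element of `N`; hence `N` acts transitively by conjugation on the coset `N x ^ i`. -/
theorem exists_mem_zpowers_mul_of_nonabelian [hN : N.Normal]
    (hmin : ∀ Z : Subgroup G, Z.Normal → Z < N → Z = ⊥)
    (hNc : ∀ a ∈ N, ∀ b ∈ N, a * b = b * a)
    {x : G} (hx : ∀ g : G, ∃ k : ℤ, (x ^ k)⁻¹ * g ∈ N)
    (hcyc : ∀ (K : Subgroup G) [K.Normal], K ≠ ⊥ → IsCyclic (G ⧸ K))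
    (hnonab : ¬ ∀ a b : G, a * b = b * a) {y : G} (hy : y ∉ N) :
    ∃ n ∈ N, y ∈ Subgroup.zpowers (n * x) := by
  obtain ⟨i, hi⟩ := hx y
  have hxi : x ^ i ∉ N := fun h => hy (by simpa using N.mul_mem h hi)
  have hu : y * (x ^ i)⁻¹ ∈ N := by
    have := hN.conj_mem _ hi (x ^ i)
    simpa using this
  have hNx : ∀ g : G, ∃ n ∈ N, ∃ k : ℤ, g = x ^ k * n := fun g => by
    obtain ⟨k, hk⟩ := hx g
    exact ⟨_, hk, k, by group⟩
  have hinj : ∀ c ∈ N, c * x ^ i = x ^ i * c → c = 1 := by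
    have hC : (N ⊓ Subgroup.centralizer {x ^ i}).Normal := by
      refine ⟨fun c hc g => ⟨hN.conj_mem c hc.1 g, ?_⟩⟩
      obtain ⟨n, hn, k, rfl⟩ := hNx g
      have h1 : n * c * n⁻¹ = c := by rw [hNc n hn c hc.1, mul_inv_cancel_right]
      have h2 : x ^ k * n * c * (x ^ k * n)⁻¹ = x ^ k * c * (x ^ k)⁻¹ := by
        calc x ^ k * n * c * (x ^ k * n)⁻¹ = x ^ k * (n * c * n⁻¹) * (x ^ k)⁻¹ := by group
          _ = _ := by rw [h1]
      rw [h2]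
      have h3 : x ^ i * c = c * x ^ i := Subgroup.mem_centralizer_singleton_iff.1 hc.2 |>.symm
      refine Subgroup.mem_centralizer_singleton_iff.2 ?_
      have h4 : x ^ k * x ^ i = x ^ i * x ^ k := by rw [← zpow_add, ← zpow_add, add_comm]
      have h5 : (x ^ k)⁻¹ * x ^ i = x ^ i * (x ^ k)⁻¹ := by
        rw [inv_mul_eq_iff_eq_mul, ← mul_assoc, h4, mul_inv_cancel_right]
      calc x ^ k * c * (x ^ k)⁻¹ * x ^ i = x ^ k * (c * x ^ i) * (x ^ k)⁻¹ := by
            rw [mul_assoc, h5]; group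
        _ = x ^ i * (x ^ k * c * (x ^ k)⁻¹) := by
            rw [← h3, ← mul_assoc, h4]; group
    rcases (inf_le_left : N ⊓ Subgroup.centralizer {x ^ i} ≤ N).lt_or_eq with h | h
    · intro c hc hcx
      have : c ∈ N ⊓ Subgroup.centralizer {x ^ i} :=
        ⟨hc, Subgroup.mem_centralizer_singleton_iff.2 hcx⟩
      rwa [hmin _ hC h, Subgroup.mem_bot] at this
    · exfalso
      have hcent : x ^ i ∈ Subgroup.center G := by
        rw [Subgroup.mem_center_iff]
        intro g
        obtain ⟨n, hn, k, rfl⟩ := hNx g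
        have h1 : n * x ^ i = x ^ i * n :=
          Subgroup.mem_centralizer_singleton_iff.1 (inf_eq_left.1 h hn)
        rw [mul_assoc, h1, ← mul_assoc, ← mul_assoc, ← zpow_add, ← zpow_add, add_comm]
      have hne : Subgroup.center G ≠ ⊥ := by
        intro h0
        rw [h0, Subgroup.mem_bot] at hcent
        exact hxi (hcent ▸ N.one_mem)
      have := hcyc (Subgroup.center G) hne
      have hcomm := (QuotientGroup.mk' (Subgroup.center G)).isMulCommutative_of_isCyclic_of_ker_le_center
        (QuotientGroup.ker_mk' _).le
      exact hnonab hcomm.is_comm.comm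
  let f : N → N := fun m => ⟨m * (x ^ i * (m : G)⁻¹ * (x ^ i)⁻¹),
    N.mul_mem m.2 (hN.conj_mem _ (N.inv_mem m.2) _)⟩
  have hf : Function.Injective f := by
    intro a b hab
    have h1 : (a : G) * (x ^ i * (a : G)⁻¹ * (x ^ i)⁻¹) =
      b * (x ^ i * (b : G)⁻¹ * (x ^ i)⁻¹) := congrArg Subtype.val hab
    have h1' : (a : G) * x ^ i * (a : G)⁻¹ = b * x ^ i * (b : G)⁻¹ := by
      have := congrArg (· * x ^ i) h1
      simpa [mul_assoc] using this
    have h2 := conj_inv_mul_eq h1'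
    have h3 := hinj _ (N.mul_mem (N.inv_mem a.2) b.2) (mul_inv_eq_iff_eq_mul.1 h2)
    exact Subtype.ext (inv_mul_eq_one.1 h3)
  obtain ⟨m, hm⟩ := (Finite.injective_iff_surjective.1 hf) ⟨_, hu⟩
  have hm' : (m : G) * (x ^ i * (m : G)⁻¹ * (x ^ i)⁻¹) = y * (x ^ i)⁻¹ := congrArg Subtype.val hm
  refine ⟨m * (x * (m : G)⁻¹ * x⁻¹), N.mul_mem m.2 (hN.conj_mem _ (N.inv_mem m.2) x), i, ?_⟩
  have h1 : (m : G) * (x * (m : G)⁻¹ * x⁻¹) * x = m * x * (m : G)⁻¹ := by group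
  have h2 : y = m * x ^ i * (m : G)⁻¹ := by
    have := congrArg (· * x ^ i) hm'
    simpa [mul_assoc] using this.symm
  change ((m : G) * (x * (m : G)⁻¹ * x⁻¹) * x) ^ i = y
  rw [h1, conj_zpow, h2]

/-- In a noncyclic abelian group with all proper quotients cyclic, let `x` generate the group modulo
a minimal subgroup `N`. Then `N` has prime order `r` and `x ^ r = 1`. -/
theorem exists_mem_zpowers_mul_of_abelian (hNbot : N ≠ ⊥)
    (hmin : ∀ Z : Subgroup G, Z.Normal → Z < N → Z = ⊥)
    {x : G} (hx : ∀ g : G, ∃ k : ℤ, (x ^ k)⁻¹ * g ∈ N)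
    (hcyc : ∀ (K : Subgroup G) [K.Normal], K ≠ ⊥ → IsCyclic (G ⧸ K))
    (hab : ∀ a b : G, a * b = b * a) (hncyc : ¬ IsCyclic G) {y : G} (hy : y ∉ N) :
    ∃ n ∈ N, y ∈ Subgroup.zpowers (n * x) := by
  have hnormal : ∀ K : Subgroup G, K.Normal := fun K => ⟨fun k hk g => by
    rwa [hab g k, mul_inv_cancel_right]⟩
  have hNgen : ∀ b ∈ N, b ≠ 1 → N ≤ Subgroup.zpowers b := by
    intro b hb hb1
    have hle : Subgroup.zpowers b ≤ N := Subgroup.zpowers_le.2 hb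
    rcases hle.lt_or_eq with h | h
    · exact absurd (Subgroup.zpowers_eq_bot.1 (hmin _ (hnormal _) h)) hb1
    · exact h.ge
  obtain ⟨a, ha, r, hr, har⟩ : ∃ a ∈ N, ∃ r : ℕ, r.Prime ∧ orderOf a = r := by
    have h1 : Nat.card N ≠ 1 := fun h => hNbot (Subgroup.card_eq_one.1 h)
    obtain ⟨r, hr, hdvd⟩ := Nat.exists_prime_and_dvd h1
    have := Fact.mk hr
    obtain ⟨a, ha⟩ := exists_prime_orderOf_dvd_card' r hdvd
    exact ⟨a, a.2, r, hr, by rw [← ha, Subgroup.orderOf_coe]⟩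
  have ha1 : a ≠ 1 := fun h => hr.ne_one (by rw [← har, h, orderOf_one])
  have har1 : a ^ (r : ℤ) = 1 := by rw [zpow_natCast, ← har, pow_orderOf_eq_one]
  -- No cyclic subgroup generated by an element of `N x` meets `N`, as it would be everything.
  have hmeet : ∀ n ∈ N, ∀ k : ℤ, (n * x) ^ k ∈ N → (n * x) ^ k = 1 := by
    intro n hn k hk
    by_contra h1
    have hle : N ≤ Subgroup.zpowers (n * x) :=
      (hNgen _ hk h1).trans (Subgroup.zpowers_le.2 ⟨k, rfl⟩)
    have hxm : x ∈ Subgroup.zpowers (n * x) := by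
      have := mul_mem (inv_mem (hle hn)) (Subgroup.mem_zpowers (n * x))
      rwa [inv_mul_cancel_left] at this
    refine hncyc ⟨n * x, fun g => ?_⟩
    obtain ⟨j, hj⟩ := hx g
    have := mul_mem (zpow_mem hxm j) (hle hj)
    rwa [mul_inv_cancel_left] at this
  have hmeet1 : ∀ k : ℤ, x ^ k ∈ N → x ^ k = 1 := by
    intro k hk
    have := hmeet 1 N.one_mem k
    rw [one_mul] at this
    exact this hk
  have hrs : (r : ℤ) ∣ orderOf x := by
    have h1 : (a * x) ^ (orderOf x : ℤ) = a ^ (orderOf x : ℤ) := by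
      rw [(show Commute a x from hab a x).mul_zpow, zpow_natCast x, pow_orderOf_eq_one, mul_one]
    have h2 := hmeet a ha (orderOf x) (h1 ▸ N.zpow_mem ha _)
    rw [h1] at h2
    rw [← har]
    exact orderOf_dvd_iff_zpow_eq_one.2 h2
  have hcop : ∀ k : ℤ, ¬ (r : ℤ) ∣ k → ∃ u v : ℤ, u * k + v * r = 1 := by
    intro k hk
    have h1 : IsCoprime k (r : ℤ) :=
      ((Nat.prime_iff_prime_int.1 hr).irreducible.coprime_iff_not_dvd.2 hk).symm
    obtain ⟨u, v, h⟩ := h1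
    exact ⟨u, v, h⟩
  have hxr : x ^ (r : ℤ) = 1 := by
    by_contra hne
    set K := Subgroup.zpowers (x ^ (r : ℤ)) with hK
    have hKn : K.Normal := hnormal K
    have hKbot : K ≠ ⊥ := fun h => hne (Subgroup.zpowers_eq_bot.1 h)
    obtain ⟨z, hz⟩ := (isCyclic_quotient_iff K).1 (hcyc K hKbot)
    have hzr : z ^ (r : ℤ) ∈ K := by
      obtain ⟨j, hj⟩ := hx z
      have h1 : z = x ^ j * ((x ^ j)⁻¹ * z) := by group
      have h2 : ((x ^ j)⁻¹ * z) ^ (r : ℤ) = 1 := by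
        obtain ⟨t, ht⟩ := hNgen a ha ha1 hj
        have ht' : a ^ t = (x ^ j)⁻¹ * z := ht
        rw [← ht', ← zpow_mul, mul_comm, zpow_mul, har1, one_zpow]
      rw [h1, (show Commute _ _ from hab _ _).mul_zpow, h2, mul_one, ← zpow_mul, mul_comm, zpow_mul]
      exact zpow_mem (Subgroup.mem_zpowers _) j
    obtain ⟨k, hk⟩ := hz a
    obtain ⟨l, hl⟩ := hz x
    have hKx : K ≤ Subgroup.zpowers x := Subgroup.zpowers_le.2 ⟨r, rfl⟩
    have hkr : ¬ (r : ℤ) ∣ k := by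
      rintro ⟨t, rfl⟩
      have h1 : z ^ ((r : ℤ) * t) ∈ K := by
        rw [zpow_mul]
        exact zpow_mem hzr t
      have h2 : a ∈ K := by
        have := mul_mem h1 hk
        rwa [mul_inv_cancel_left] at this
      obtain ⟨j, hj⟩ := hKx h2
      have hj' : x ^ j = a := hj
      exact ha1 (hj' ▸ hmeet1 j (hj' ▸ ha))
    obtain ⟨u, v, huv⟩ := hcop k hkr
    -- Modulo `K`, `z = a ^ u` and hence `x = a ^ (u * l)`.
    have hzu : (a ^ u)⁻¹ * z ∈ K := by
      have h1 : (a ^ u)⁻¹ * z = (((z ^ k)⁻¹ * a) ^ u)⁻¹ * (z ^ (r : ℤ)) ^ v := by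
        rw [(show Commute _ _ from hab _ _).mul_zpow, mul_inv_rev, mul_assoc, inv_zpow, inv_inv,
          ← zpow_mul, ← zpow_mul, ← zpow_add]
        congr 1
        rw [mul_comm k u, mul_comm (r : ℤ) v, huv, zpow_one]
      rw [h1]
      exact mul_mem (inv_mem (zpow_mem hk u)) (zpow_mem hzr v)
    have hxu : (a ^ (u * l))⁻¹ * x ∈ K := by
      have h1 : (a ^ (u * l))⁻¹ * x = ((a ^ u)⁻¹ * z) ^ l * ((z ^ l)⁻¹ * x) := by
        rw [(show Commute _ _ from hab _ _).mul_zpow, inv_zpow, ← zpow_mul]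
        group
      rw [h1]
      exact mul_mem (zpow_mem hzu l) hl
    obtain ⟨j, hj⟩ := hxu
    have hj' : (x ^ (r : ℤ)) ^ j = (a ^ (u * l))⁻¹ * x := hj
    have h2 : x ^ (1 - r * j) = a ^ (u * l) := by
      rw [zpow_sub, zpow_one, zpow_mul, hj', mul_inv_rev, inv_inv, mul_inv_cancel_left]
    have h3 := hmeet1 (1 - r * j) (h2 ▸ N.zpow_mem ha _)
    have h4 : (r : ℤ) ∣ 1 - r * j := hrs.trans (orderOf_dvd_iff_zpow_eq_one.2 h3)
    have h5 : (r : ℤ) ∣ 1 := by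
      have := dvd_add h4 (dvd_mul_right (r : ℤ) j)
      rwa [sub_add_cancel] at this
    exact (Nat.prime_iff_prime_int.1 hr).not_dvd_one h5
  obtain ⟨i, hi⟩ := hx y
  obtain ⟨j, hj⟩ := hNgen a ha ha1 hi
  have hj' : a ^ j = (x ^ i)⁻¹ * y := hj
  have hir : ¬ (r : ℤ) ∣ i := by
    rintro ⟨t, rfl⟩
    refine hy ?_
    rwa [zpow_mul, hxr, one_zpow, inv_one, one_mul] at hi
  obtain ⟨u, v, huv⟩ := hcop i hir
  refine ⟨a ^ (j * u), N.zpow_mem ha _, i, ?_⟩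
  have h1 : a ^ (j * u * i) = a ^ j := by
    have h2 : j * u * i = j - r * (v * j) := by linear_combination j * huv
    rw [h2, zpow_sub, zpow_mul a r, har1, one_zpow, inv_one, mul_one]
  change (a ^ (j * u) * x) ^ i = y
  rw [(show Commute _ _ from hab _ _).mul_zpow, ← zpow_mul, h1, hj', hab, mul_inv_cancel_left]

/-- A noncyclic group with all proper quotients cyclic is covered by a minimal normal abelian
subgroup `N` and the `|N|` cyclic subgroups generated by the elements of a coset of `N`. -/
theorem groupSum_le_of_critical [hN : N.Normal] (hNbot : N ≠ ⊥)
    (hmin : ∀ Z : Subgroup G, Z.Normal → Z < N → Z = ⊥)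
    (hNc : ∀ a ∈ N, ∀ b ∈ N, a * b = b * a)
    (hcyc : ∀ (K : Subgroup G) [K.Normal], K ≠ ⊥ → IsCyclic (G ⧸ K)) (hncyc : ¬ IsCyclic G) :
    groupSum G ≤ (Nat.card N : ℕ∞) + 1 := by
  obtain ⟨x, hx⟩ := (isCyclic_quotient_iff N).1 (hcyc N hNbot)
  have hcover : IsSubgroupCover G
      (insert N (Set.range fun n : N => Subgroup.zpowers ((n : G) * x))) := by
    refine ⟨?_, fun y => ?_⟩
    · rintro H (rfl | ⟨n, rfl⟩) htop
      · obtain ⟨a, ha, ha1⟩ := H.bot_or_exists_ne_one.resolve_left hNbot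
        have hn : (Subgroup.zpowers (a : G)).Normal := ⟨fun k hk g => by
          rwa [hNc g (htop ▸ Subgroup.mem_top g) k (htop ▸ Subgroup.mem_top k),
            mul_inv_cancel_right]⟩
        rcases (Subgroup.zpowers_le.2 ha).lt_or_eq with h | h
        · exact ha1 (Subgroup.zpowers_eq_bot.1 (hmin _ hn h))
        · refine hncyc ⟨a, fun g => ?_⟩
          have : g ∈ Subgroup.zpowers a := h.ge (htop ▸ Subgroup.mem_top g)
          exact this
      · refine hncyc ⟨(n : G) * x, fun g => ?_⟩
        have h1 : Subgroup.zpowers ((n : G) * x) = ⊤ := htop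
        have : g ∈ Subgroup.zpowers ((n : G) * x) := h1 ▸ Subgroup.mem_top g
        exact this
    · by_cases hy : y ∈ N
      · exact ⟨N, Set.mem_insert _ _, hy⟩
      · obtain ⟨n, hn, hyn⟩ : ∃ n ∈ N, y ∈ Subgroup.zpowers (n * x) := by
          by_cases hab : ∀ a b : G, a * b = b * a
          · exact exists_mem_zpowers_mul_of_abelian hNbot hmin hx hcyc hab hncyc hy
          · exact exists_mem_zpowers_mul_of_nonabelian hmin hNc hx hcyc hab hy
        exact ⟨_, Set.mem_insert_of_mem _ ⟨⟨n, hn⟩, rfl⟩, hyn⟩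
  refine hcover.groupSum_le.trans ((Set.encard_insert_le _ _).trans ?_)
  gcongr
  rw [← Set.image_univ]
  refine (Set.encard_image_le _ _).trans ?_
  rw [Set.encard_univ, ENat.card_eq_coe_natCard]

end Critical

/-! ### Covers from chains -/

/-- A noncyclic group that is cyclic modulo an abelian normal subgroup `D` is a union of `|D| + 1`
proper subgroups: pass to a noncyclic quotient all of whose proper quotients are cyclic. -/
theorem groupSum_le_of_abelian_by_cyclic {G : Type*} [Group G] [Finite G] (D : Subgroup G)
    [hD : D.Normal] (hDc : ∀ a ∈ D, ∀ b ∈ D, a * b = b * a) (hcyc : IsCyclic (G ⧸ D))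
    (hncyc : ¬ IsCyclic G) : groupSum G ≤ (Nat.card D : ℕ∞) + 1 := by
  induction hm : Nat.card G using Nat.strong_induction_on generalizing G with
  | _ m ih =>
  subst hm
  by_cases h : ∃ K : Subgroup G, ∃ _ : K.Normal, K ≠ ⊥ ∧ ¬ IsCyclic (G ⧸ K)
  · obtain ⟨K, hK, hKbot, hKncyc⟩ := h
    have hsurj := QuotientGroup.mk'_surjective K
    have hDn : (D.map (QuotientGroup.mk' K)).Normal := hD.map _ hsurj
    have hlt : Nat.card (G ⧸ K) < Nat.card G := by
      rw [← Subgroup.index_eq_card]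
      exact Subgroup.index_lt_card_of_ne_bot hKbot
    have h1 := ih _ hlt (D.map (QuotientGroup.mk' K)) (by
      rintro _ ⟨a, ha, rfl⟩ _ ⟨b, hb, rfl⟩
      rw [← map_mul, ← map_mul, hDc a ha b hb]) (isCyclic_quotient_map hcyc) hKncyc rfl
    refine (groupSum_le_of_surjective _ hsurj).trans (h1.trans ?_)
    gcongr
    exact Nat.le_of_dvd Nat.card_pos (Subgroup.card_map_dvd _ _)
  · push Not at h
    have hcyc' : ∀ (K : Subgroup G) [K.Normal], K ≠ ⊥ → IsCyclic (G ⧸ K) :=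
      fun K hK hKb => h K hK hKb
    have hDbot : ⊥ < D := by
      rw [bot_lt_iff_ne_bot]
      rintro rfl
      exact hncyc (isCyclic_of_quotient_bot hcyc)
    obtain ⟨N, hN, hNbot, hND, hmin⟩ := exists_chief_above hDbot
    refine (groupSum_le_of_critical hNbot.ne' (fun Z hZ hZN => hmin Z hZ bot_le hZN)
      (fun a ha b hb => hDc a (hND ha) b (hND hb)) hcyc' hncyc).trans ?_
    gcongr
    exact Subgroup.card_le_of_le hND

theorem AbStep.groupSum_le {G : Type*} [Group G] [Finite G] {n : ℕ} {X Y : Subgroup G}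
    (h : AbStep n X Y) [hX : X.Normal] [hY : Y.Normal] (hcyc : IsCyclic (G ⧸ X))
    (hncyc : ¬ IsCyclic (G ⧸ Y)) : groupSum (G ⧸ Y) ≤ (n : ℕ∞) + 1 := by
  have hsurj := QuotientGroup.mk'_surjective Y
  have hXn : (X.map (QuotientGroup.mk' Y)).Normal := hX.map _ hsurj
  refine (groupSum_le_of_abelian_by_cyclic (X.map (QuotientGroup.mk' Y)) ?_
    (isCyclic_quotient_map hcyc) hncyc).trans ?_
  · rintro _ ⟨a, ha, rfl⟩ _ ⟨b, hb, rfl⟩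
    rw [← commutatorElement_eq_one_iff_mul_comm, ← map_commutatorElement]
    exact (QuotientGroup.eq_one_iff _).2 (h.comm (Subgroup.commutator_mem_commutator ha hb))
  · gcongr
    refine le_trans (le_of_eq ?_) h.relIndex_le
    calc Nat.card (X.map (QuotientGroup.mk' Y)) = (QuotientGroup.mk' Y).ker.relIndex X :=
          (Subgroup.relIndex_ker X _).symm
      _ = Y.relIndex X := congrArg (fun T : Subgroup G => T.relIndex X) (QuotientGroup.ker_mk' Y)

theorem AbChain.le {G : Type*} [Group G] {n : ℕ} {X Y : Subgroup G} (h : AbChain n X Y) :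
    Y ≤ X := by
  induction h with
  | refl => exact le_rfl
  | tail _ hs ih => exact hs.le.trans ih

/-- The first noncyclic quotient along a chain of normal subgroups with abelian factors of order at
most `n` is a union of `n + 1` proper subgroups. -/
theorem AbChain.groupSum_le {G : Type*} [Group G] [Finite G] {n : ℕ} {X Y : Subgroup G}
    (h : AbChain n X Y) [hX : X.Normal] [hY : Y.Normal] (hcyc : IsCyclic (G ⧸ X))
    (hncyc : ¬ IsCyclic (G ⧸ Y)) : groupSum (G ⧸ Y) ≤ (n : ℕ∞) + 1 := by
  revert hcyc
  revert hX
  induction h using Relation.ReflTransGen.head_induction_on with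
  | refl => exact fun hcyc => absurd hcyc hncyc
  | @head X' Z hs hc ih =>
    intro hX hcyc
    have hZ : Z.Normal := hs.normal_right
    by_cases hZc : IsCyclic (G ⧸ Z)
    · exact ih hZc
    · exact (groupSum_quotient_le_of_le (AbChain.le hc)).trans (hs.groupSum_le hcyc hZc)

/-! ### Lower bounds and the characterization -/

theorem card_add_one_le_encard {ι α : Type*} [Finite ι] {F : Set α} (f : ι → α)
    (hf : Function.Injective f) (hfF : ∀ i, f i ∈ F) {K : α} (hK : K ∈ F) (hne : ∀ i, f i ≠ K) :
    (Nat.card ι : ℕ∞) + 1 ≤ F.encard := by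
  have h1 : K ∉ Set.range f := by
    rintro ⟨i, hi⟩
    exact hne i hi
  have h2 : (Set.range f).encard = Nat.card ι := by
    rw [← Set.image_univ, hf.encard_image, Set.encard_univ, ENat.card_eq_coe_natCard]
  rw [← h2, ← Set.encard_insert_of_notMem h1]
  refine Set.encard_le_encard (Set.insert_subset hK ?_)
  rintro _ ⟨i, rfl⟩
  exact hfF i

/-- Let `x` generate the group modulo a minimal normal abelian subgroup `N`. A proper subgroup
containing an element of the coset `N x` meets `N` trivially, so it contains only one element of that
coset. Hence a cover has at least `|N|` such members, and they do not cover `N`. -/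
theorem card_add_one_le_groupSum_of_isCyclic_quotient {G : Type*} [Group G] [Finite G]
    {N : Subgroup G} [hN : N.Normal] (hNbot : N ≠ ⊥)
    (hmin : ∀ Z : Subgroup G, Z.Normal → Z < N → Z = ⊥)
    (hNc : ∀ a ∈ N, ∀ b ∈ N, a * b = b * a) (hcyc : IsCyclic (G ⧸ N)) :
    (Nat.card N : ℕ∞) + 1 ≤ groupSum G := by
  obtain ⟨x, hx⟩ := (isCyclic_quotient_iff N).1 hcyc
  refine le_groupSum fun F hF => ?_
  choose H hHF hxH using fun n : N => hF.2 ((n : G) * x)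
  have hmeet : ∀ n : N, N ⊓ H n = ⊥ := by
    intro n
    have hgen : ∀ g : G, ∃ k : ℤ, (((n : G) * x) ^ k)⁻¹ * g ∈ N := by
      intro g
      obtain ⟨k, hk⟩ := hx g
      refine ⟨k, QuotientGroup.eq.1 ?_⟩
      rw [← QuotientGroup.eq.2 hk, QuotientGroup.mk_zpow, QuotientGroup.mk_zpow,
        QuotientGroup.mk_mul, (QuotientGroup.eq_one_iff (n : G)).2 n.2, one_mul]
    have hnormal : (N ⊓ H n).Normal := by
      refine ⟨fun c hc g => ⟨hN.conj_mem c hc.1 g, ?_⟩⟩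
      obtain ⟨k, hk⟩ := hgen g
      set y := ((n : G) * x) ^ k with hy
      have hyH : y ∈ H n := zpow_mem (hxH n) k
      have h1 : g * c * g⁻¹ = y * ((y⁻¹ * g) * c * (y⁻¹ * g)⁻¹) * y⁻¹ := by group
      rw [h1, hNc _ hk c hc.1, mul_inv_cancel_right]
      exact mul_mem (mul_mem hyH hc.2) ((H n).inv_mem hyH)
    rcases (inf_le_left : N ⊓ H n ≤ N).lt_or_eq with h | h
    · exact hmin _ hnormal h
    · exfalso
      refine hF.1 _ (hHF n) ?_
      rw [eq_top_iff]
      intro g _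
      obtain ⟨k, hk⟩ := hgen g
      have := mul_mem (zpow_mem (hxH n) k) (inf_eq_left.1 h hk)
      rwa [mul_inv_cancel_left] at this
  obtain ⟨a, ha, ha1⟩ := N.bot_or_exists_ne_one.resolve_left hNbot
  obtain ⟨K, hKF, haK⟩ := hF.2 a
  refine card_add_one_le_encard H (fun m n hmn => ?_) hHF hKF fun n hn => ha1 ?_
  · have h1 : (m : G) * (n : G)⁻¹ ∈ H m := by
      have h2 := mul_mem (hxH m) ((H m).inv_mem (hmn ▸ hxH n : (n : G) * x ∈ H m))
      have h3 : (m : G) * x * ((n : G) * x)⁻¹ = m * (n : G)⁻¹ := by group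
      rwa [h3] at h2
    have h2 : (m : G) * (n : G)⁻¹ ∈ N ⊓ H m := ⟨mul_mem m.2 (N.inv_mem n.2), h1⟩
    rw [hmeet, Subgroup.mem_bot] at h2
    exact Subtype.ext (mul_inv_eq_one.1 h2)
  · have h1 : a ∈ N ⊓ H n := ⟨ha, hn.symm ▸ haK⟩
    rwa [hmeet, Subgroup.mem_bot] at h1

/-- If `σ(G) < σ(G / N)`, then some maximal subgroup does not contain `N`. -/
theorem exists_isCoatom_not_le {G : Type*} [Group G] [Finite G] {N : Subgroup G} [N.Normal]
    (h : groupSum G < groupSum (G ⧸ N)) : ∃ H : Subgroup G, IsCoatom H ∧ ¬ N ≤ H := by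
  by_contra! hall
  refine h.not_ge (le_groupSum fun F hF => ?_)
  choose! M hM hHM using fun (H : Subgroup G) (hH : H ∈ F) =>
    (eq_top_or_exists_le_coatom H).resolve_left (hF.1 H hH)
  have hF' : IsSubgroupCover G (M '' F) := by
    refine ⟨?_, fun g => ?_⟩
    · rintro _ ⟨H, hH, rfl⟩
      exact (hM H hH).1
    · obtain ⟨H, hH, hg⟩ := hF.2 g
      exact ⟨_, ⟨H, hH, rfl⟩, hHM H hH hg⟩
  refine (hF'.groupSum_quotient_le N ?_).trans (Set.encard_image_le _ _)
  rintro _ ⟨H, hH, rfl⟩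
  exact hall _ (hM H hH)

section Complement

variable {G : Type*} [Group G] {N H : Subgroup G} [hN : N.Normal]

theorem exists_eq_mul_of_isCoatom (hH : IsCoatom H) (hNH : ¬ N ≤ H) (g : G) :
    ∃ a ∈ N, ∃ m ∈ H, g = a * m := by
  have hsup : N ⊔ H = ⊤ :=
    (hH.le_iff.1 le_sup_right).resolve_right fun h => hNH (h ▸ le_sup_left)
  obtain ⟨a, ha, m, hm, h⟩ := Subgroup.mem_sup_of_normal_left.1 (hsup ▸ Subgroup.mem_top g)
  exact ⟨a, ha, m, hm, h.symm⟩

theorem inf_eq_bot_of_isCoatom (hmin : ∀ Z : Subgroup G, Z.Normal → Z < N → Z = ⊥)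
    (hNc : ∀ a ∈ N, ∀ b ∈ N, a * b = b * a) (hH : IsCoatom H) (hNH : ¬ N ≤ H) : N ⊓ H = ⊥ := by
  refine hmin _ ⟨fun c hc g => ⟨hN.conj_mem c hc.1 g, ?_⟩⟩
    (lt_of_le_of_ne inf_le_left fun h => hNH (inf_eq_left.1 h))
  obtain ⟨a, ha, m, hm, rfl⟩ := exists_eq_mul_of_isCoatom hH hNH g
  have h1 : m * c * m⁻¹ ∈ N := hN.conj_mem c hc.1 m
  have h2 : a * m * c * (a * m)⁻¹ = a * (m * c * m⁻¹) * a⁻¹ := by group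
  rw [h2, hNc a ha _ h1, mul_inv_cancel_right]
  exact mul_mem (mul_mem hm hc.2) (H.inv_mem hm)

/-- If `σ(G) < σ(G / N)` for a noncentral minimal normal abelian subgroup `N` with complement `H`,
then every cover with fewer than `σ(G / N)` members contains all conjugates of `H`, since the trace
of the cover on a conjugate that is not a member would give a cover of `G / N`. -/
theorem card_add_one_le_groupSum_of_lt [Finite G] (hNbot : N ≠ ⊥)
    (hmin : ∀ Z : Subgroup G, Z.Normal → Z < N → Z = ⊥)
    (hNc : ∀ a ∈ N, ∀ b ∈ N, a * b = b * a) (hH : IsCoatom H) (hNH : ¬ N ≤ H)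
    (hNZ : N ⊓ Subgroup.center G = ⊥) (hlt : groupSum G < groupSum (G ⧸ N)) :
    (Nat.card N : ℕ∞) + 1 ≤ groupSum G := by
  by_contra! hcon
  obtain ⟨_, ⟨F, hF, rfl⟩, hFlt⟩ := sInf_lt_iff.1 (lt_min hcon hlt)
  have hFN : F.encard < groupSum (G ⧸ N) := hFlt.trans_le (min_le_right _ _)
  refine (hFlt.trans_le (min_le_left _ _)).not_ge ?_
  let f : N → Subgroup G := fun n => (MulAut.conj (n : G)).mapSubgroup H
  have mem_f : ∀ (n : N) (g : G), g ∈ f n ↔ (n : G)⁻¹ * g * n ∈ H := by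
    intro n g
    constructor
    · rintro ⟨m, hm, rfl⟩
      have h1 : (n : G)⁻¹ * ((n : G) * m * (n : G)⁻¹) * n = m := by group
      exact h1.symm ▸ hm
    · intro h
      refine ⟨_, h, ?_⟩
      change (n : G) * ((n : G)⁻¹ * g * n) * (n : G)⁻¹ = g
      group
  have hcoatom : ∀ n, IsCoatom (f n) := fun n =>
    ((MulAut.conj (n : G)).mapSubgroup.isCoatom_iff H).2 hH
  have hfN : ∀ n, ¬ N ≤ f n := by
    intro n h
    refine hNH fun a ha => ?_
    have h1 := (mem_f n _).1 (h (hN.conj_mem a ha n))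
    have h2 : (n : G)⁻¹ * ((n : G) * a * (n : G)⁻¹) * n = a := by group
    rwa [h2] at h1
  have hmeet : ∀ n, N ⊓ f n = ⊥ := fun n => inf_eq_bot_of_isCoatom hmin hNc (hcoatom n) (hfN n)
  have hfF : ∀ n, f n ∈ F := by
    intro n
    by_contra hn
    have hF' : IsSubgroupCover G ((fun M => (M ⊓ f n) ⊔ N) '' F) := by
      refine ⟨?_, fun g => ?_⟩
      · rintro _ ⟨M, hM, rfl⟩ htop
        have hle : f n ≤ M := by
          intro y hy
          have hy' : y ∈ (M ⊓ f n) ⊔ N := by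
            have h1 : (M ⊓ f n) ⊔ N = ⊤ := htop
            rw [h1]
            exact Subgroup.mem_top y
          obtain ⟨u, hu, v, hv, rfl⟩ := Subgroup.mem_sup_of_normal_right.1 hy'
          have hv' : v ∈ N ⊓ f n := by
            refine ⟨hv, ?_⟩
            have := mul_mem ((f n).inv_mem hu.2) hy
            rwa [inv_mul_cancel_left] at this
          rw [hmeet, Subgroup.mem_bot] at hv'
          rw [hv', mul_one]
          exact hu.1
        rcases (hcoatom n).le_iff.1 hle with h | h
        · exact hF.1 M hM h
        · exact hn (h ▸ hM)
      · obtain ⟨a, ha, m, hm, rfl⟩ := exists_eq_mul_of_isCoatom (hcoatom n) (hfN n) g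
        obtain ⟨M, hM, hmM⟩ := hF.2 m
        refine ⟨_, ⟨M, hM, rfl⟩, ?_⟩
        exact mul_mem (Subgroup.mem_sup_right ha) (Subgroup.mem_sup_left ⟨hmM, hm⟩)
    refine hFN.not_ge ((hF'.groupSum_quotient_le N ?_).trans (Set.encard_image_le _ _))
    rintro _ ⟨M, -, rfl⟩
    exact le_sup_right
  obtain ⟨a, ha, ha1⟩ := N.bot_or_exists_ne_one.resolve_left hNbot
  obtain ⟨K, hKF, haK⟩ := hF.2 a
  refine card_add_one_le_encard f (fun n n' hnn => ?_) hfF hKF fun n hn => ha1 ?_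
  · have hcN : (n : G)⁻¹ * n' ∈ N := mul_mem (inv_mem n.2) n'.2
    set c := (n : G)⁻¹ * n' with hc
    have hcH : ∀ m ∈ H, c * m = m * c := by
      intro m hm
      have h1 : (n' : G) * m * (n' : G)⁻¹ ∈ f n := by
        rw [hnn, mem_f]
        have h2 : (n' : G)⁻¹ * ((n' : G) * m * (n' : G)⁻¹) * n' = m := by group
        rwa [h2]
      have h2 : c * m * c⁻¹ ∈ H := by
        have h3 := (mem_f n _).1 h1
        have h4 : (n : G)⁻¹ * ((n' : G) * m * (n' : G)⁻¹) * n = c * m * c⁻¹ := by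
          rw [hc]; group
        rwa [h4] at h3
      have h3 : c * m * c⁻¹ * m⁻¹ ∈ N ⊓ H := by
        refine ⟨?_, H.mul_mem h2 (H.inv_mem hm)⟩
        have h4 : c * m * c⁻¹ * m⁻¹ = c * (m * c⁻¹ * m⁻¹) := by group
        rw [h4]
        exact mul_mem hcN (hN.conj_mem _ (inv_mem hcN) m)
      rw [inf_eq_bot_of_isCoatom hmin hNc hH hNH, Subgroup.mem_bot] at h3
      exact commutatorElement_eq_one_iff_mul_comm.1 h3
    have hcZ : c ∈ N ⊓ Subgroup.center G := by
      refine ⟨hcN, Subgroup.mem_center_iff.2 fun g => ?_⟩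
      obtain ⟨b, hb, m, hm, rfl⟩ := exists_eq_mul_of_isCoatom hH hNH g
      rw [mul_assoc, ← hcH m hm, ← mul_assoc, hNc b hb c hcN, mul_assoc]
    rw [hNZ, Subgroup.mem_bot, hc] at hcZ
    exact Subtype.ext (inv_mul_eq_one.1 hcZ)
  · have h1 : a ∈ N ⊓ f n := ⟨ha, hn.symm ▸ haK⟩
    rwa [hmeet, Subgroup.mem_bot] at h1

/-- The centralizer in `H` of an abelian normal subgroup `N` with complement `H` is normal, and its
quotient in the centralizer of `N` is isomorphic to `N`. -/
theorem abStep_centralizer_inf [Finite G] (hNc : ∀ a ∈ N, ∀ b ∈ N, a * b = b * a)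
    (hH : IsCoatom H) (hNH : ¬ N ≤ H) :
    AbStep (Nat.card N) (Subgroup.centralizer (N : Set G))
      (Subgroup.centralizer (N : Set G) ⊓ H) := by
  set C := Subgroup.centralizer (N : Set G) with hC
  have memC : ∀ {g}, g ∈ C ↔ ∀ a ∈ N, a * g = g * a := fun {g} => Subgroup.mem_centralizer_iff
  have hNC : N ≤ C := fun a ha => memC.2 fun b hb => hNc b hb a ha
  have hCn : C.Normal := inferInstance
  have hdec : ∀ c ∈ C, ∃ a ∈ N, ∃ m ∈ C ⊓ H, c = a * m := by
    intro c hc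
    obtain ⟨a, ha, m, hm, rfl⟩ := exists_eq_mul_of_isCoatom hH hNH c
    have : m ∈ C := by
      have := mul_mem (inv_mem (hNC ha)) hc
      rwa [inv_mul_cancel_left] at this
    exact ⟨a, ha, m, ⟨this, hm⟩, rfl⟩
  refine ⟨hCn, ⟨fun c hc g => ⟨hCn.conj_mem c hc.1 g, ?_⟩⟩, inf_le_left, ?_, ?_⟩
  · obtain ⟨a, ha, m, hm, rfl⟩ := exists_eq_mul_of_isCoatom hH hNH g
    have h1 : m * c * m⁻¹ ∈ C := hCn.conj_mem c hc.1 m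
    have h2 : a * m * c * (a * m)⁻¹ = a * (m * c * m⁻¹) * a⁻¹ := by group
    rw [h2, memC.1 h1 a ha, mul_inv_cancel_right]
    exact mul_mem (mul_mem hm hc.2) (H.inv_mem hm)
  · refine Subgroup.commutator_le.2 fun c hc d hd => ?_
    obtain ⟨a, ha, m, hm, rfl⟩ := hdec c hc
    obtain ⟨b, hb, k, hk, rfl⟩ := hdec d hd
    have h1 : ⁅a * m, b * k⁆ = ⁅m, k⁆ := by
      have e1 : a * m * (b * k) = (b * a) * (m * k) := by
        rw [hNc b hb a ha, mul_assoc, ← mul_assoc m, ← memC.1 hm.1 b hb]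
        simp only [mul_assoc]
      have e2 : b * k * (a * m) = (b * a) * (k * m) := by
        rw [mul_assoc, ← mul_assoc k, ← memC.1 hk.1 a ha]
        simp only [mul_assoc]
      have e3 : ∀ x y : G, ⁅x, y⁆ = (x * y) * (y * x)⁻¹ := fun x y => by
        simp only [commutatorElement_def]; group
      have hmk : ⁅m, k⁆ ∈ C := by
        rw [e3]
        exact mul_mem (mul_mem hm.1 hk.1) (inv_mem (mul_mem hk.1 hm.1))
      have h2 := memC.1 hmk (b * a) (mul_mem hb ha)
      rw [e3, e1, e2]
      rw [e3] at h2
      rw [mul_inv_rev (b * a), e3, ← mul_assoc, mul_assoc (b * a), h2, mul_inv_cancel_right]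
    rw [h1]
    exact (Subgroup.commutator_le_self _) (Subgroup.commutator_mem_commutator hm hk)
  · choose a ha m hm h using fun c : C => hdec c c.2
    refine relIndex_le_card_of_injOn (S := N) (fun c => ⟨a c, ha c⟩) fun x y hxy => ?_
    have hxy' : a x = a y := congrArg Subtype.val hxy
    have h1 : (x : G)⁻¹ * y = (m x)⁻¹ * m y := by
      conv_lhs => rw [h x, h y, hxy']
      group
    rw [h1]
    exact mul_mem (inv_mem (hm x)) (hm y)

end Complement

theorem isMinimalNormal_iff {G : Type*} [Group G] {N : Subgroup G} :
    IsMinimalNormal N ↔ N.Normal ∧ N ≠ ⊥ ∧ ∀ Z : Subgroup G, Z.Normal → Z < N → Z = ⊥ := by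
  constructor
  · intro h
    refine ⟨h.prop.1, h.prop.2, fun Z hZ hZN => ?_⟩
    by_contra hne
    exact hZN.not_ge (h.le_of_le ⟨hZ, hne⟩ hZN.le)
  · rintro ⟨h1, h2, h3⟩
    refine ⟨⟨h1, h2⟩, fun Z hZ hZN => ?_⟩
    rcases hZN.lt_or_eq with h | h
    · exact absurd (h3 Z hZ.1 h) hZ.2
    · exact h.ge

theorem groupSocle_eq {G : Type*} [Group G] {N : Subgroup G} (hN : IsMinimalNormal N)
    (huniq : ∀ M : Subgroup G, IsMinimalNormal M → M = N) : groupSocle G = N := by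
  have : {M : Subgroup G | IsMinimalNormal M} = {N} :=
    Set.eq_singleton_iff_unique_mem.2 ⟨hN, huniq⟩
  rw [groupSocle, this, sSup_singleton]

theorem IsMinimalNormal.commute {G : Type*} [Group G] [Group.IsSolvable G] {N : Subgroup G}
    (hN : IsMinimalNormal N) : ∀ a ∈ N, ∀ b ∈ N, a * b = b * a := by
  obtain ⟨h1, h2, h3⟩ := isMinimalNormal_iff.1 hN
  have h := commutator_le_of_chief (K := ⊥) (W := N) (bot_lt_iff_ne_bot.2 h2) fun Z hZ _ hZN => h3 Z hZ hZN
  intro a ha b hb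
  exact commutatorElement_eq_one_iff_mul_comm.1
    (Subgroup.mem_bot.1 (h (Subgroup.commutator_mem_commutator ha hb)))

/-- A nonabelian solvable `σ`-elementary group has a unique minimal normal subgroup `N`, and `G / N`
is cyclic. Here `N` is found inside the derived subgroup, so a complement `H` of `N` is not normal.
-/
theorem IsSigmaElementary.exists_minimalNormal {G : Type*} [Group G] [Finite G]
    [Group.IsSolvable G] (hnonab : ¬ ∀ a b : G, a * b = b * a) (hG : IsSigmaElementary G) :
    ∃ N : Subgroup G, ∃ _ : N.Normal, IsMinimalNormal N ∧
      (∀ M : Subgroup G, IsMinimalNormal M → M = N) ∧ IsCyclic (G ⧸ N) := by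
  have hder : (⊥ : Subgroup G) < ⁅(⊤ : Subgroup G), (⊤ : Subgroup G)⁆ := by
    rw [bot_lt_iff_ne_bot]
    intro h
    refine hnonab fun a b => commutatorElement_eq_one_iff_mul_comm.1 (Subgroup.mem_bot.1 ?_)
    rw [← h]
    exact Subgroup.commutator_mem_commutator (Subgroup.mem_top a) (Subgroup.mem_top b)
  obtain ⟨N, hN, hNbot, hNder, hmin'⟩ := exists_chief_above hder
  have hmin : ∀ Z : Subgroup G, Z.Normal → Z < N → Z = ⊥ := fun Z hZ hZN => hmin' Z hZ bot_le hZN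
  have hNmin : IsMinimalNormal N := isMinimalNormal_iff.2 ⟨hN, hNbot.ne', hmin⟩
  have hNc := hNmin.commute
  have hlt := hG N hNbot.ne'
  obtain ⟨H, hH, hNH⟩ := exists_isCoatom_not_le hlt
  have hderH : ¬ ⁅(⊤ : Subgroup G), (⊤ : Subgroup G)⁆ ≤ H := fun h => hNH (hNder.trans h)
  have hNZ : N ⊓ Subgroup.center G = ⊥ := by
    refine hmin _ inferInstance (lt_of_le_of_ne inf_le_left fun h => hderH ?_)
    have hcen : ∀ a ∈ N, ∀ g : G, g * a = a * g := fun a ha =>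
      Subgroup.mem_center_iff.1 (inf_eq_left.1 h ha)
    refine Subgroup.commutator_le.2 fun g _ g' _ => ?_
    obtain ⟨a, ha, m, hm, rfl⟩ := exists_eq_mul_of_isCoatom hH hNH g
    obtain ⟨b, hb, k, hk, rfl⟩ := exists_eq_mul_of_isCoatom hH hNH g'
    have h1 : ⁅a * m, b * k⁆ = ⁅m, k⁆ := by
      calc ⁅a * m, b * k⁆ = a * (m * b) * k * m⁻¹ * a⁻¹ * k⁻¹ * b⁻¹ := by
            simp only [commutatorElement_def]; group
        _ = a * b * (⁅m, k⁆ * (k * a⁻¹)) * k⁻¹ * b⁻¹ := by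
            rw [hcen b hb m]; simp only [commutatorElement_def]; group
        _ = a * (b * ⁅m, k⁆) * a⁻¹ * b⁻¹ := by
            rw [hcen a⁻¹ (inv_mem ha) k]; group
        _ = (a * ⁅m, k⁆) * (b * a⁻¹) * b⁻¹ := by rw [← hcen b hb ⁅m, k⁆]; group
        _ = ⁅m, k⁆ := by rw [← hcen a ha ⁅m, k⁆, hNc b hb a⁻¹ (inv_mem ha)]; group
    rw [h1]
    simp only [commutatorElement_def]
    exact H.mul_mem (H.mul_mem (H.mul_mem hm hk) (H.inv_mem hm)) (H.inv_mem hk)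
  have hlow := card_add_one_le_groupSum_of_lt hNbot.ne' hmin hNc hH hNH hNZ hlt
  set C := Subgroup.centralizer (N : Set G) with hC
  have hCn : C.Normal := inferInstance
  have hNC : N ≤ C := fun a ha => Subgroup.mem_centralizer_iff.2 fun b hb => hNc b hb a ha
  have hCeq : sectionCentralizer ⊥ N = C := by
    ext g
    rw [mem_sectionCentralizer, hC, Subgroup.mem_centralizer_iff]
    refine forall₂_congr fun a _ => ?_
    rw [Subgroup.mem_bot, commutatorElement_eq_one_iff_mul_comm, eq_comm]
  have htopC : AbChain (Nat.card N) ⊤ C := by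
    have h := abChain_sectionCentralizer hNbot hmin'
    rwa [hCeq, Subgroup.relIndex_bot_left] at h
  have hstep := abStep_centralizer_inf hNc hH hNH
  have htriv : IsCyclic (G ⧸ (⊤ : Subgroup G)) :=
    (isCyclic_quotient_iff ⊤).2 ⟨1, fun g => ⟨0, Subgroup.mem_top _⟩⟩
  have hK : C ⊓ H = ⊥ := by
    have hKn : (C ⊓ H).Normal := hstep.normal_right
    by_contra hKbot
    have hncyc : ¬ IsCyclic (G ⧸ (C ⊓ H)) := by
      intro hcyc
      refine hderH (Subgroup.commutator_le.2 fun a _ b _ => ?_)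
      have h1 : ((⁅a, b⁆ : G) : G ⧸ (C ⊓ H)) = 1 := by
        have h2 : QuotientGroup.mk' (C ⊓ H) ⁅a, b⁆ = 1 := by
          rw [map_commutatorElement, commutatorElement_eq_one_iff_mul_comm]
          have := hcyc.isMulCommutative
          exact this.is_comm.comm _ _
        exact h2
      exact ((QuotientGroup.eq_one_iff _).1 h1).2
    have h := AbChain.groupSum_le (htopC.tail hstep) htriv hncyc
    exact (hG (C ⊓ H) hKbot).not_ge (h.trans hlow)
  have hCN : C = N := by
    refine le_antisymm (fun c hc => ?_) hNC
    obtain ⟨a, ha, m, hm, rfl⟩ := exists_eq_mul_of_isCoatom hH hNH c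
    have hmC : m ∈ C ⊓ H := by
      refine ⟨?_, hm⟩
      have := mul_mem (inv_mem (hNC ha)) hc
      rwa [inv_mul_cancel_left] at this
    rw [hK, Subgroup.mem_bot] at hmC
    rwa [hmC, mul_one]
  refine ⟨N, hN, hNmin, fun M hM => ?_, ?_⟩
  · obtain ⟨hMn, hMbot, hMmin⟩ := isMinimalNormal_iff.1 hM
    by_cases hNM : N ≤ M
    · rcases hNM.lt_or_eq with h | h
      · exact absurd (hMmin N hN h) hNbot.ne'
      · exact h.symm
    · have hdis : N ⊓ M = ⊥ := hmin _ inferInstance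
        (lt_of_le_of_ne inf_le_left fun h => hNM (inf_eq_left.1 h))
      have hMC : M ≤ C := by
        intro x hx
        refine Subgroup.mem_centralizer_iff.2 fun a ha => ?_
        exact Subgroup.commute_of_normal_of_disjoint N M hN hMn (disjoint_iff.2 hdis) a x ha hx
      rw [hCN] at hMC
      rcases hMC.lt_or_eq with h | h
      · exact absurd (hmin M hMn h) hMbot
      · exact h
  · by_contra hncyc
    rw [hCN] at htopC
    exact hlt.not_ge ((htopC.groupSum_le htriv hncyc).trans hlow)

theorem theorem6 (G : Type*) [Group G] [Finite G] (hsolv : Group.IsSolvable G)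
    (hnonab : ¬ ∀ a b : G, a * b = b * a) :
    (IsSigmaElementary G ↔ IsMonolithic G ∧ IsCyclic (G ⧸ groupSocle G)) ∧
      (IsSigmaElementary G → groupSum G = (Nat.card (groupSocle G) : ℕ∞) + 1) := by
  have hncyc : ¬ IsCyclic G := fun h => hnonab h.isMulCommutative.is_comm.comm
  refine ⟨⟨fun hG => ?_, ?_⟩, fun hG => ?_⟩
  · obtain ⟨N, hN, hNmin, huniq, hcyc⟩ := hG.exists_minimalNormal hnonab
    exact ⟨⟨N, hNmin, huniq⟩, isCyclic_quotient_of_le (groupSocle_eq hNmin huniq).ge hcyc⟩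
  · rintro ⟨⟨N, hNmin, huniq⟩, hcyc⟩ M hM hMbot
    obtain ⟨W, hW, hWbot, hWM, hWmin⟩ := exists_chief_above (bot_lt_iff_ne_bot.2 hMbot)
    have hWN : W = N := huniq W
      (isMinimalNormal_iff.2 ⟨hW, hWbot.ne', fun Z hZ hZW => hWmin Z hZ bot_le hZW⟩)
    have hcycM : IsCyclic (G ⧸ M) :=
      isCyclic_quotient_of_le ((groupSocle_eq hNmin huniq).le.trans (hWN ▸ hWM)) hcyc
    rw [(groupSum_eq_top_iff (G ⧸ M)).2 hcycM, lt_top_iff_ne_top, Ne, groupSum_eq_top_iff]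
    exact hncyc
  · obtain ⟨N, hN, hNmin, huniq, hcyc⟩ := hG.exists_minimalNormal hnonab
    obtain ⟨-, hNbot, hmin⟩ := isMinimalNormal_iff.1 hNmin
    rw [groupSocle_eq hNmin huniq]
    exact le_antisymm (groupSum_le_of_abelian_by_cyclic N hNmin.commute hcyc hncyc)
      (card_add_one_le_groupSum_of_isCyclic_quotient hNbot hmin hNmin.commute hcyc)
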